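/- Conventions. A building is a simplicial complex $\Delta$ (the empty simplex included) admitting an apartment system, i.e. a set $\mathcal A$ of subcomplexes (apartments) such that: each apartment is a Coxeter complex of finite rank, i.e. isomorphic to the standard Coxeter complex $\Sigma(W,S)$ of a Coxeter system with $S$ finite; any two simplices of $\Delta$ lie in a common apartment; and if two apartments $\Sigma,\Sigma'$ both contain simplices $A$ and $B$, there is a simplicial isomorphism $\Sigma\to\Sigma'$ fixing $A$ and $B$ pointwise. Chambers are the maximal simplices, $\mathrm{Ch}(\cdot)$ denotes the set of chambers, and panels are the simplices of codimension one in a chamber. Two chambers are adjacent if they are different and share a panel. A building is thick if each panel lies in at least three chambers. It is $2$-spherical if its apartments are isomorphic to $\Sigma(W,S)$ for a Coxeter system $(W,S)$ such that $st$ has finite order for all $s,t\in S$. A subbuilding of a building $\Delta'$ with apartment system $\mathcal A'$ is a subcomplex of $\Delta'$ which is a building having an apartment system contained in $\mathcal A'$. Proposition. Let $\Delta$ be a thick building and $\Delta'$ an arbitrary building, endowed with arbitrary apartment systems $\mathcal A$ and $\mathcal A'$, respectively. Let $\varphi:\mathrm{Ch}(\Delta)\to\mathrm{Ch}(\Delta')$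 be a map such that for every $\Sigma\in\mathcal A$ there is $\Sigma'\in\mathcal A'$ for which $\varphi$ maps $\mathrm{Ch}(\Sigma)$ bijectively onto $\mathrm{Ch}(\Sigma')$. Then $\varphi$ is injective, and any two chambers $C,D$ of $\Delta$ are adjacent if and only if $\varphi(C),\varphi(D)$ are adjacent. Furthermore, $\varphi(\mathrm{Ch}(\Delta))$ is the set of chambers of a thick subbuilding $\Gamma$ of $\Delta'$; and if $\Delta$ is $2$-spherical, $\varphi$ induces a simplicial isomorphism of $\Delta$ onto $\Gamma$, i.e. there is a simplicial isomorphism $\Delta\to\Gamma$ mapping each chamber $C$ of $\Delta$ to $\varphi(C)$. -/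

import Mathlib

/-- An abstract simplicial complex with vertices taken from `V`, in the convention of building
theory: the empty set is always a simplex (it is the panel contained in every chamber of a complex
of rank one, and the unique chamber of a complex of rank zero). An element of `V` is a vertex only
if its singleton is a simplex, so that a complex and its subcomplexes live on the same type. -/
@[ext]
structure SimplexComplex (V : Type*) where
  faces : Set (Finset V)
  empty_mem : ∅ ∈ faces
  down_closed : ∀ s ∈ faces, ∀ t, t ⊆ s → t ∈ faces

namespace SimplexComplex

/-- `K ≤ L` means that `K` is a subcomplex of `L`. -/
instance {V : Type*} : LE (SimplexComplex V) where
  le K L := K.faces ⊆ L.faces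

/-- The set of vertices of a complex. -/
def vertices {V : Type*} (K : SimplexComplex V) : Set V := {v | {v} ∈ K.faces}

/-- The set of chambers, that is, of maximal simplices. -/
def chambers {V : Type*} (K : SimplexComplex V) : Set (Finset V) :=
  {C | Maximal (fun s => s ∈ K.faces) C}

/-- A panel is a simplex of codimension one in some chamber. -/
def IsPanel {V : Type*} (K : SimplexComplex V) (P : Finset V) : Prop :=
  ∃ C ∈ K.chambers, P ⊆ C ∧ P.card + 1 = C.card

/-- Two chambers are adjacent if they are different and share a common panel. -/
def Adjacent {V : Type*} (K : SimplexComplex V) (C D : K.chambers) : Prop :=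
  C ≠ D ∧ ∃ P : Finset V, K.IsPanel P ∧ P ⊆ C.1 ∧ P ⊆ D.1

/-- A complex is thick if every panel is contained in at least three chambers. -/
def IsThick {V : Type*} (K : SimplexComplex V) : Prop :=
  ∀ P : Finset V, K.IsPanel P → 3 ≤ {C | C ∈ K.chambers ∧ P ⊆ C}.encard

/-- A simplicial isomorphism: a bijection between the vertex sets such that a finite set of
vertices is a simplex if and only if its image is one. -/
structure Iso {V V' : Type*} (K : SimplexComplex V) (L : SimplexComplex V') where
  toEquiv : K.vertices ≃ L.vertices
  map_faces : ∀ s : Finset K.vertices,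
    s.map (Function.Embedding.subtype _) ∈ K.faces ↔
      (s.map toEquiv.toEmbedding).map (Function.Embedding.subtype _) ∈ L.faces

/-- The image of a simplex (given by its vertex set) under a simplicial isomorphism. -/
def Iso.imageOf {V V' : Type*} {K : SimplexComplex V} {L : SimplexComplex V'}
    (e : Iso K L) (s : Finset V) : Set V' :=
  {w | ∃ v : K.vertices, v.1 ∈ s ∧ (e.toEquiv v).1 = w}

end SimplexComplex

/-- The maximal standard parabolic subgroup of the Coxeter group of `M` generated by all simple
reflections but the `i`-th one. -/
def CoxeterMatrix.maxParabolic {B : Type*} (M : CoxeterMatrix B) (i : B) : Subgroup M.Group :=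
  Subgroup.closure (M.simple '' {j | j ≠ i})

/-- The standard Coxeter complex `Σ(W, S)` of a Coxeter matrix. Its vertices are the left cosets
`w W_{S ∖ {s}}`, and the simplices are the sets of vertices of the standard cosets `w W_J`
with `J ⊆ S`, that is, the sets of such cosets (for pairwise different `s`) with a common
representative `w`; the chamber belonging to `w` consists of all `w W_{S ∖ {s}}` with `s ∈ S`. -/
def CoxeterMatrix.coxeterComplex {B : Type*} (M : CoxeterMatrix B) :
    SimplexComplex (Σ i : B, M.Group ⧸ M.maxParabolic i) where
  faces := {s | ∃ w : M.Group, ∀ v ∈ s, v.2 = (w : M.Group ⧸ M.maxParabolic v.1)}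
  empty_mem := ⟨1, by simp⟩
  down_closed := by
    rintro s ⟨w, hw⟩ t hts
    exact ⟨w, fun v hv => hw v (hts hv)⟩

namespace SimplexComplex

/-- `K` is a Coxeter complex (of finite rank, so that buildings are finite-dimensional). -/
def IsCoxeterComplex {V : Type*} (K : SimplexComplex V) : Prop :=
  ∃ (n : ℕ) (M : CoxeterMatrix (Fin n)), Nonempty (Iso K M.coxeterComplex)

/-- `𝓐` is a system of apartments of `Δ`, so that `Δ` is a (possibly non-thick) building. That
`Δ` is the union of its apartments is the case `A = B` of `exists_apartment`. -/
structure IsApartmentSystem {V : Type*} (Δ : SimplexComplex V)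
    (𝓐 : Set (SimplexComplex V)) : Prop where
  le : ∀ K ∈ 𝓐, K ≤ Δ
  isCoxeterComplex : ∀ K ∈ 𝓐, K.IsCoxeterComplex
  exists_apartment : ∀ A ∈ Δ.faces, ∀ B ∈ Δ.faces, ∃ K ∈ 𝓐, A ∈ K.faces ∧ B ∈ K.faces
  exists_iso : ∀ K ∈ 𝓐, ∀ L ∈ 𝓐, ∀ A B : Finset V,
    A ∈ K.faces → B ∈ K.faces → A ∈ L.faces → B ∈ L.faces →
      ∃ e : Iso K L, ∀ v : K.vertices, v.1 ∈ A ∨ v.1 ∈ B → (e.toEquiv v).1 = v.1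

/-- A subbuilding of a building `Δ` with apartment system `𝓐`: a subcomplex which is a building
with respect to some set of apartments taken from `𝓐`. -/
def IsSubbuilding {V : Type*} (Γ Δ : SimplexComplex V) (𝓐 : Set (SimplexComplex V)) : Prop :=
  Γ ≤ Δ ∧ ∃ 𝓑 ⊆ 𝓐, IsApartmentSystem Γ 𝓑

/-- A building with apartment system `𝓐` is 2-spherical if it is of type `(W, S)`, that is, its
apartments are isomorphic to `Σ(W, S)`, where `(W, S)` is a Coxeter system in which `s t` has
finite order `m(s, t)` for all `s, t ∈ S` (the entry `0` of a Coxeter matrix stands for `∞`). -/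
def IsTwoSpherical {V : Type*} (𝓐 : Set (SimplexComplex V)) : Prop :=
  ∃ (n : ℕ) (M : CoxeterMatrix (Fin n)), (∀ i j, M i j ≠ 0) ∧
    ∀ K ∈ 𝓐, Nonempty (Iso K M.coxeterComplex)

end SimplexComplex

/-!
The theorem concerns arbitrary apartment systems, for which the intersection of all apartments
containing two chambers can be larger than their convex hull. What remains true in a thick building
is that the intersection of all apartments containing two *adjacent* chambers `C` and `D` contains no
further chamber (`exists_notMem_of_adjacent`). Since apartments are convex, a chamber strictly
between `φ C` and `φ D` would come from this intersection, so that `φ C` and `φ D` are adjacent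
(`MapsApartments.adjacent_map`). For the converse, a third chamber through the first panel of a
minimal gallery from `C` to `D` gives an apartment avoiding `C` whose image would have to contain
`φ C` by convexity (`MapsApartments.adjacent_iff`). Injectivity is clear because two chambers lie in
a common apartment, and the image is a subbuilding whose apartments are the images of apartments.
It is thick because three chambers on a panel are pairwise adjacent, and pairwise adjacent chambers
have a common panel (`inter_subset_of_adjacent`).

The passage from chambers to vertices in the 2-spherical case matches the panels of `C` with those
of `φ C`, hence the vertices opposite to them (`Corresponds`). This must not depend on `C`. In an
apartment it is a statement about an isometry between two Coxeter groups: if `s i` and `s j`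
generate a finite group, its longest element and the exchange condition show that the isometry
carries the corner `w`, `w s j`, `w s j s i` to a corner of the types prescribed at `w`
(`isometry_mul_simple`). As stars of vertices are gallery connected, the vertex map is well defined.

The building theory rests on the retraction onto an apartment centered at a chamber
(`exists_retraction`), constructed by comparing labellings of apartments (`Chart`); it yields the
gallery distance in apartments and their convexity. About Coxeter groups one needs that different
simple reflections are different, proved with the reflection representation, and the exchange
condition, proved with the action of the group on pairs of an element and a sign.
-/

/-! ### Reflection representation and exchange condition -/

namespace CoxeterMatrix

variable {B : Type*} (M : CoxeterMatrix B)

/-- The linear form `v ↦ 2 ⟨e i, v⟩` on the reflection representation, where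
`⟨e i, e j⟩ = - cos (π / M i j)`. For `M i j = 0` the junk value `π / 0 = 0` gives
`⟨e i, e j⟩ = -1`, as desired. -/
noncomputable def rootForm (i : B) : Module.Dual ℝ (B →₀ ℝ) :=
  Finsupp.linearCombination ℝ fun j => -2 * Real.cos (Real.pi / M i j)

theorem rootForm_single (i j : B) :
    M.rootForm i (Finsupp.single j 1) = -2 * Real.cos (Real.pi / M i j) := by
  simp [rootForm]

theorem rootForm_self (i : B) : M.rootForm i (Finsupp.single i 1) = 2 := by
  rw [rootForm_single, M.diagonal]
  simp

/-- The simple reflection `v ↦ v - 2 ⟨e i, v⟩ e i` of the reflection representation. -/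
noncomputable def rootReflection (i : B) : (B →₀ ℝ) ≃ₗ[ℝ] (B →₀ ℝ) :=
  Module.reflection (M.rootForm_self i)

open Polynomial.Chebyshev in
/-- The reflections of the reflection representation satisfy the Coxeter relations. For `3 ≤ M i j`
this is read off from the values of Chebyshev polynomials at `2 * cos (2 * π / M i j)`. -/
theorem isLiftable_rootReflection : M.IsLiftable M.rootReflection := by
  intro i j
  by_cases hij : i = j
  · subst hij
    rw [M.diagonal, pow_one]
    ext1 v
    exact Module.involutive_reflection (M.rootForm_self i) v
  have h1 : M i j ≠ 1 := M.off_diagonal i j hij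
  have hsymm : M j i = M i j := M.symmetric j i
  rcases Nat.lt_or_ge 2 (M i j) with h | h
  swap
  · obtain h0 | h2 : M i j = 0 ∨ M i j = 2 := by omega
    · simp [h0]
    · have hc1 : M.rootForm i (Finsupp.single j 1) = 0 := by
        rw [rootForm_single, h2]; simp
      have hc2 : M.rootForm j (Finsupp.single i 1) = 0 := by
        rw [rootForm_single, hsymm, h2]; simp
      rw [h2, pow_two]
      apply LinearEquiv.ext
      intro v
      simp only [rootReflection, LinearEquiv.mul_apply, Module.reflection_apply, map_sub, map_smul,
        hc1, hc2, rootForm_self, LinearEquiv.coe_one, id]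
      module
  · apply LinearEquiv.ext
    intro v
    set m := M i j with hm
    set θ : ℝ := 2 * (Real.pi / m) with hθ
    have hm0 : (m : ℝ) ≠ 0 := by positivity
    have hmθ : m * θ = 2 * Real.pi := by rw [hθ]; field_simp
    have hm3 : (3 : ℝ) ≤ m := by exact_mod_cast h
    have hs : Real.sin θ ≠ 0 := by
      apply ne_of_gt
      apply Real.sin_pos_of_pos_of_lt_pi
      · have := Real.pi_pos
        positivity
      · have := Real.pi_pos
        nlinarith
    have ht : 2 * Real.cos θ = M.rootForm i (Finsupp.single j 1) *
        M.rootForm j (Finsupp.single i 1) - 2 := by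
      rw [rootForm_single, rootForm_single, hsymm, hθ, Real.cos_two_mul]
      ring
    have key := Module.reflection_mul_reflection_pow_apply (M.rootForm_self i) (M.rootForm_self j)
      m v (2 * Real.cos θ) ht
    have e1 : (S ℝ (((m : ℤ) - 2) / 2)).eval (2 * Real.cos θ) *
        ((S ℝ (((m : ℤ) - 1) / 2)).eval (2 * Real.cos θ) +
          (S ℝ (((m : ℤ) - 3) / 2)).eval (2 * Real.cos θ)) = 0 ∧
        (S ℝ (((m : ℤ) - 1) / 2)).eval (2 * Real.cos θ) *
        ((S ℝ ((m : ℤ) / 2)).eval (2 * Real.cos θ) +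
          (S ℝ (((m : ℤ) - 2) / 2)).eval (2 * Real.cos θ)) = 0 := by
      have hS : ∀ n : ℤ, (S ℝ n).eval (2 * Real.cos θ) = Real.sin ((n + 1) * θ) / Real.sin θ :=
        fun n => by rw [← S_two_mul_real_cos]; field_simp
      rcases Nat.even_or_odd' m with ⟨k, hk | hk⟩
      · have hkθ : k * θ = Real.pi := by
          have : (m : ℝ) = 2 * k := by rw [hk]; push_cast; ring
          rw [this] at hmθ; linarith
        have hz : (S ℝ ((k : ℤ) - 1)).eval (2 * Real.cos θ) = 0 := by
          rw [hS]; push_cast; rw [sub_add_cancel, hkθ]; simp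
        have a1 : ((m : ℤ) - 2) / 2 = k - 1 := by omega
        have a2 : ((m : ℤ) - 1) / 2 = k - 1 := by omega
        rw [a1, a2, hz]
        simp
      · have hkθ : (2 * k + 1) * θ = 2 * Real.pi := by
          rw [← hmθ, hk]; push_cast; ring
        have hz : (S ℝ (k : ℤ)).eval (2 * Real.cos θ) +
            (S ℝ ((k : ℤ) - 1)).eval (2 * Real.cos θ) = 0 := by
          rw [hS, hS]; push_cast
          have : ((k : ℝ) + 1) * θ = 2 * Real.pi - k * θ := by linarith
          rw [sub_add_cancel, this, Real.sin_two_pi_sub]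
          ring
        have a1 : ((m : ℤ) - 2) / 2 = k - 1 := by omega
        have a2 : ((m : ℤ) - 1) / 2 = k := by omega
        have a3 : ((m : ℤ) - 3) / 2 = k - 1 := by omega
        have a4 : (m : ℤ) / 2 = k := by omega
        rw [a1, a2, a3, a4, hz]
        simp
    rw [e1.1, e1.2] at key
    simpa [rootReflection] using key

/-- Different simple reflections of a Coxeter group are different. -/
theorem simple_injective : Function.Injective M.simple := by
  classical
  intro i j h
  by_contra hij
  let ρ := M.toCoxeterSystem.lift ⟨M.rootReflection, M.isLiftable_rootReflection⟩
  have hρ : ∀ k, ρ (M.simple k) = M.rootReflection k := fun k => by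
    have := M.toCoxeterSystem.lift_apply_simple M.isLiftable_rootReflection k
    rwa [M.toCoxeterSystem_simple] at this
  have h2 : M.rootReflection i = M.rootReflection j := by rw [← hρ, ← hρ, h]
  have h3 := congrArg (fun r => r (Finsupp.single i (1 : ℝ)) i) h2
  simp only [rootReflection, Module.reflection_apply, rootForm_self, Finsupp.sub_apply,
    Finsupp.smul_apply, Finsupp.single_apply, if_true, if_neg (Ne.symm hij)] at h3
  norm_num at h3

end CoxeterMatrix

namespace CoxeterSystem

open List

variable {B W : Type*} [Group W] {M : CoxeterMatrix B} (cs : CoxeterSystem M W)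

open Classical in
/-- The involution `(t, ε) ↦ (s i * t * s i, ε + [t = s i])` of `W × ZMod 2`. These maps define an
action of `W`, whose second component counts, modulo 2, the occurrences of an element in the
inversion sequence of a word. -/
noncomputable def inversionPerm (i : B) : Equiv.Perm (W × ZMod 2) :=
  Function.Involutive.toPerm
    (fun p => (cs.simple i * p.1 * cs.simple i, p.2 + if p.1 = cs.simple i then 1 else 0)) <| by
    intro p
    have h : cs.simple i * p.1 * cs.simple i = cs.simple i ↔ p.1 = cs.simple i := by
      constructor
      · intro h
        have := congrArg (fun x => cs.simple i * x * cs.simple i) h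
        simpa [mul_assoc] using this
      · intro h; simp [h]
    ext
    · simp [mul_assoc]
    · simp only [h]
      split_ifs
      · rw [add_assoc, CharTwo.add_self_eq_zero, add_zero]
      · simp

open Classical in
theorem inversionPerm_apply (i : B) (p : W × ZMod 2) :
    cs.inversionPerm i p =
      (cs.simple i * p.1 * cs.simple i, p.2 + if p.1 = cs.simple i then 1 else 0) :=
  rfl

open Classical in
theorem prod_inversionPerm_apply (ω : List B) (t : W) (ε : ZMod 2) :
    (ω.map cs.inversionPerm).prod (t, ε) =
      (cs.wordProd ω * t * (cs.wordProd ω)⁻¹, ε + ((cs.rightInvSeq ω).count t : ZMod 2)) := by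
  induction ω with
  | nil => simp
  | cons i ω ih =>
    rw [map_cons, prod_cons, Equiv.Perm.mul_apply, ih]
    have h : cs.wordProd ω * t * (cs.wordProd ω)⁻¹ = cs.simple i ↔
        (cs.wordProd ω)⁻¹ * cs.simple i * cs.wordProd ω = t := by
      constructor <;> rintro h
      · rw [← h]; group
      · rw [← h]; group
    rw [inversionPerm_apply]
    simp only [rightInvSeq, count_cons, h, beq_iff_eq, wordProd_cons, mul_inv_rev, inv_simple]
    refine Prod.ext (by simp [mul_assoc]) ?_
    push_cast
    split_ifs <;> simp [add_assoc]

theorem map_alternatingWord_prod {G : Type*} [Monoid G] (f : B → G) (i j : B) (m : ℕ) :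
    ((alternatingWord i j (2 * m)).map f).prod = (f i * f j) ^ m := by
  induction m with
  | zero => simp [alternatingWord]
  | succ m ih =>
    rw [show 2 * (m + 1) = 2 * m + 1 + 1 by ring, alternatingWord, alternatingWord, pow_succ]
    simp [ih]

/-- The involutions `inversionPerm i` satisfy the Coxeter relations. -/
theorem isLiftable_inversionPerm : M.IsLiftable cs.inversionPerm := by
  classical
  intro i j
  have hπ : cs.wordProd (alternatingWord i j (2 * M i j)) = 1 := by
    rw [wordProd, map_alternatingWord_prod, simple_mul_simple_pow]
  rw [← map_alternatingWord_prod]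
  ext1 ⟨t, ε⟩
  rw [prod_inversionPerm_apply, hπ]
  -- The inversion sequence of the word `(s i * s j) ^ M i j` is a list repeated twice.
  have key : ∃ l : List W, cs.leftInvSeq (alternatingWord j i (2 * M i j)) = l ++ l := by
    refine ⟨(cs.leftInvSeq (alternatingWord j i (2 * M i j))).take (M i j), ?_⟩
    apply List.ext_getElem
    · simp; omega
    intro k hk hk'
    have hk2 : k < 2 * M i j := by simpa using hk
    rw [List.getElem_append]
    split_ifs with h
    · simp
    · have hlen : k - M i j < 2 * M i j := by omega
      simp only [List.length_take, length_leftInvSeq, length_alternatingWord] at h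
      have hMk : M i j ≤ k := by omega
      simp only [List.getElem_take, length_take, length_leftInvSeq, length_alternatingWord,
        show min (M i j) (2 * M i j) = M i j by omega]
      rw [cs.getElem_leftInvSeq_alternatingWord _ _ _ _ hk2,
        cs.getElem_leftInvSeq_alternatingWord _ _ _ _ hlen]
      simp only [alternatingWord_succ, wordProd_concat]
      rw [wordProd, wordProd, map_alternatingWord_prod, map_alternatingWord_prod]
      obtain ⟨d, rfl⟩ := Nat.exists_eq_add_of_le hMk
      rw [Nat.add_sub_cancel_left, pow_add, simple_mul_simple_pow', one_mul]
  have hrev : (alternatingWord j i (2 * M i j)).reverse = alternatingWord i j (2 * M i j) := by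
    generalize M i j = m
    induction m with
    | zero => simp [alternatingWord]
    | succ m ih =>
      rw [show 2 * (m + 1) = 2 * m + 1 + 1 by ring, alternatingWord_succ' i j,
        alternatingWord_succ' i j]
      simp [alternatingWord_succ, ih]
  obtain ⟨l, hl⟩ := key
  have : cs.rightInvSeq (alternatingWord i j (2 * M i j)) = l.reverse ++ l.reverse := by
    rw [← hrev, rightInvSeq_reverse, hl, reverse_append]
  rw [this, count_append]
  push_cast
  simp [CharTwo.add_self_eq_zero]

open Classical in
/-- Modulo 2, the number of occurrences of `t` in the right inversion sequence of a word depends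
only on the product of the word. -/
theorem count_rightInvSeq_congr {ω ω' : List B} (h : cs.wordProd ω = cs.wordProd ω') (t : W) :
    ((cs.rightInvSeq ω).count t : ZMod 2) = (cs.rightInvSeq ω').count t := by
  let ρ := cs.lift ⟨cs.inversionPerm, cs.isLiftable_inversionPerm⟩
  have hρ : ∀ η : List B, ρ (cs.wordProd η) = (η.map cs.inversionPerm).prod := fun η => by
    induction η with
    | nil => simp
    | cons i η ih =>
      rw [wordProd_cons, map_mul, ih, map_cons, prod_cons]
      congr 1
      exact cs.lift_apply_simple cs.isLiftable_inversionPerm i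
  have h1 : (ω.map cs.inversionPerm).prod (t, 0) = (ω'.map cs.inversionPerm).prod (t, 0) := by
    rw [← hρ, ← hρ, h]
  rw [prod_inversionPerm_apply, prod_inversionPerm_apply] at h1
  simpa using congrArg Prod.snd h1

/-- The exchange condition, on the right. -/
theorem exists_eraseIdx_of_isRightDescent {ω : List B} {i : B}
    (h : cs.IsRightDescent (cs.wordProd ω) i) :
    ∃ k < ω.length, cs.wordProd ω * cs.simple i = cs.wordProd (ω.eraseIdx k) := by
  classical
  obtain ⟨η, hη, hηw⟩ := cs.exists_isReduced (cs.wordProd ω * cs.simple i)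
  have hw : cs.wordProd (η.concat i) = cs.wordProd ω := by
    rw [wordProd_concat, ← hηw]; simp
  have hred : cs.IsReduced (η.concat i) := by
    rw [IsReduced, hw, length_concat, ← hη.eq, ← hηw]
    exact ((cs.isRightDescent_iff).1 h).symm
  have hmem : cs.simple i ∈ cs.rightInvSeq (η.concat i) := by
    rw [rightInvSeq_concat]; simp
  have hc := cs.count_rightInvSeq_congr hw (cs.simple i)
  rw [List.count_eq_one_of_mem hred.nodup_rightInvSeq hmem] at hc
  have hmem' : cs.simple i ∈ cs.rightInvSeq ω := by
    by_contra hn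
    rw [List.count_eq_zero_of_not_mem hn] at hc
    simp at hc
  obtain ⟨k, hk, hk'⟩ := List.getElem_of_mem hmem'
  refine ⟨k, by simpa using hk, ?_⟩
  rw [← cs.wordProd_mul_getD_rightInvSeq, ← hk', List.getD_eq_getElem _ _ hk]

end CoxeterSystem

/-! ### Descents and parabolic subgroups -/

namespace CoxeterSystem

open List

variable {B W : Type*} [Group W] {M : CoxeterMatrix B} (cs : CoxeterSystem M W)

/-- The exchange condition inside the dihedral subgroup generated by two descents: an element with
two different right descents `i` and `j` has a reduced word that ends with `i j`. -/
theorem IsRightDescent.mul_simple {w : W} {i j : B} (hi : cs.IsRightDescent w i)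
    (hj : cs.IsRightDescent w j) (hij : cs.simple i ≠ cs.simple j) :
    cs.IsRightDescent (w * cs.simple j) i := by
  obtain ⟨ω, hω, hωw⟩ := cs.exists_isReduced (w * cs.simple i)
  have hw : cs.wordProd (ω.concat i) = w := by
    rw [wordProd_concat, ← hωw]; simp
  have hlen : ω.length + 1 = cs.length w := by
    rw [← hω.eq, ← hωw]
    exact cs.isRightDescent_iff.1 hi
  have hj' : cs.IsRightDescent (cs.wordProd (ω.concat i)) j := by rwa [hw]
  obtain ⟨k, hk, hk'⟩ := cs.exists_eraseIdx_of_isRightDescent hj'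
  rw [hw] at hk'
  rw [length_concat] at hk
  rw [concat_eq_append] at hk'
  rcases Nat.lt_or_ge k ω.length with hkω | hkω
  · rw [List.eraseIdx_append_of_lt_length hkω, wordProd_append, wordProd_singleton] at hk'
    have h1 : w * cs.simple j * cs.simple i = cs.wordProd (ω.eraseIdx k) := by
      rw [hk']; simp
    have h2 := cs.length_wordProd_le (ω.eraseIdx k)
    have h3 := List.length_eraseIdx_add_one hkω
    have h4 := cs.isRightDescent_iff.1 hj
    rw [IsRightDescent, h1]
    omega
  · obtain rfl : k = ω.length := by omega
    rw [List.eraseIdx_append_of_length_le (le_refl _)] at hk'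
    simp only [Nat.sub_self, eraseIdx_cons_zero, append_nil] at hk'
    rw [← hωw] at hk'
    exact absurd (mul_left_cancel hk').symm hij

end CoxeterSystem

namespace CoxeterMatrix

variable {B : Type*} (M : CoxeterMatrix B)

/-- The length of an element of a Coxeter group with respect to the simple reflections. -/
noncomputable abbrev len (w : M.Group) : ℕ := M.toCoxeterSystem.length w

theorem simple_mul_self (i : B) : M.simple i * M.simple i = 1 :=
  M.toCoxeterSystem.simple_mul_simple_self i

theorem simple_inv (i : B) : (M.simple i)⁻¹ = M.simple i :=
  M.toCoxeterSystem.inv_simple i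

theorem mul_simple_mul_simple (w : M.Group) (i : B) : w * M.simple i * M.simple i = w := by
  rw [mul_assoc, simple_mul_self, mul_one]

theorem simple_ne_one (i : B) : M.simple i ≠ 1 := by
  intro h
  have := M.toCoxeterSystem.length_simple i
  rw [M.toCoxeterSystem_simple, h, CoxeterSystem.length_one] at this
  exact zero_ne_one this

theorem simple_mem_maxParabolic {i j : B} (h : j ≠ i) : M.simple j ∈ M.maxParabolic i :=
  Subgroup.subset_closure ⟨j, h, rfl⟩

variable {M}

/-- An element of a standard parabolic subgroup has a reduced word in its generators. -/
theorem exists_isReduced_of_mem_closure {J : Set B} {w : M.Group}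
    (hw : w ∈ Subgroup.closure (M.simple '' J)) :
    ∃ ω : List B, M.toCoxeterSystem.IsReduced ω ∧ (∀ i ∈ ω, i ∈ J) ∧
      M.toCoxeterSystem.wordProd ω = w := by
  have step : ∀ x : M.Group, ∀ j ∈ J, (∃ ω : List B, M.toCoxeterSystem.IsReduced ω ∧
      (∀ i ∈ ω, i ∈ J) ∧ M.toCoxeterSystem.wordProd ω = x) →
      ∃ ω : List B, M.toCoxeterSystem.IsReduced ω ∧
      (∀ i ∈ ω, i ∈ J) ∧ M.toCoxeterSystem.wordProd ω = x * M.simple j := by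
    rintro x j hj ⟨ω, hω, hωJ, rfl⟩
    by_cases hd : M.toCoxeterSystem.IsRightDescent (M.toCoxeterSystem.wordProd ω) j
    · obtain ⟨k, hk, hk'⟩ := M.toCoxeterSystem.exists_eraseIdx_of_isRightDescent hd
      refine ⟨ω.eraseIdx k, ?_, fun i hi => hωJ i (List.mem_of_mem_eraseIdx hi), hk'.symm⟩
      have h1 := M.toCoxeterSystem.isRightDescent_iff.1 hd
      have h2 := List.length_eraseIdx_add_one hk
      rw [CoxeterSystem.IsReduced, ← hk']
      rw [hω.eq] at h1
      omega
    · refine ⟨ω.concat j, ?_, ?_, by rw [CoxeterSystem.wordProd_concat]; rfl⟩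
      · rw [CoxeterSystem.IsReduced, CoxeterSystem.wordProd_concat, List.length_concat,
          M.toCoxeterSystem.not_isRightDescent_iff.1 hd, hω.eq]
      · intro i hi
        rw [List.concat_eq_append, List.mem_append, List.mem_singleton] at hi
        rcases hi with hi | rfl
        · exact hωJ i hi
        · exact hj
  induction hw using Subgroup.closure_induction_right with
  | one => exact ⟨[], by simp [CoxeterSystem.IsReduced], by simp, by simp⟩
  | mul_right x hx y hy ih =>
    obtain ⟨j, hj, rfl⟩ := hy
    exact step x j hj ih
  | mul_inv_cancel x hx y hy ih =>
    obtain ⟨j, hj, rfl⟩ := hy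
    rw [simple_inv]
    exact step x j hj ih

/-- The descents of an element of a standard parabolic subgroup belong to its generators. -/
theorem mem_of_isRightDescent {J : Set B} {w : M.Group}
    (hw : w ∈ Subgroup.closure (M.simple '' J)) {i : B}
    (hi : M.toCoxeterSystem.IsRightDescent w i) : i ∈ J := by
  have hmem : ∀ ω : List B, (∀ i ∈ ω, i ∈ J) →
      M.toCoxeterSystem.wordProd ω ∈ Subgroup.closure (M.simple '' J) := by
    intro ω hω
    induction ω with
    | nil => rw [CoxeterSystem.wordProd_nil]; exact one_mem _
    | cons k ω ih =>
      rw [CoxeterSystem.wordProd_cons]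
      exact mul_mem (Subgroup.subset_closure ⟨k, hω k (by simp), rfl⟩)
        (ih fun i hi => hω i (by simp [hi]))
  obtain ⟨ω, -, hωJ, rfl⟩ := exists_isReduced_of_mem_closure hw
  obtain ⟨k, hk, hk'⟩ := M.toCoxeterSystem.exists_eraseIdx_of_isRightDescent hi
  have h1 := hmem (ω.eraseIdx k) fun i hi => hωJ i (List.mem_of_mem_eraseIdx hi)
  rw [← hk', Subgroup.mul_mem_cancel_left _ hw] at h1
  obtain ⟨η, hη, hηJ, hηi⟩ := exists_isReduced_of_mem_closure h1
  have hlen := hη.eq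
  rw [hηi, CoxeterSystem.length_simple] at hlen
  obtain ⟨a, rfl⟩ := List.length_eq_one_iff.1 hlen.symm
  rw [CoxeterSystem.wordProd_singleton] at hηi
  rw [← M.simple_injective hηi]
  exact hηJ a (by simp)

theorem eq_one_of_forall_mem_maxParabolic {w : M.Group} (h : ∀ i, w ∈ M.maxParabolic i) :
    w = 1 := by
  by_contra hw
  obtain ⟨i, hi⟩ := M.toCoxeterSystem.exists_rightDescent_of_ne_one hw
  exact mem_of_isRightDescent (h i) hi rfl

/-- The intersection of all the maximal standard parabolic subgroups but the `i`-th one is generated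
by the `i`-th simple reflection. -/
theorem eq_one_or_eq_simple {w : M.Group} {i : B} (h : ∀ j ≠ i, w ∈ M.maxParabolic j) :
    w = 1 ∨ w = M.simple i := by
  have key : ∀ x : M.Group, (∀ j ≠ i, x ∈ M.maxParabolic j) → x ≠ 1 →
      M.toCoxeterSystem.IsRightDescent x i := by
    intro x hx hx1
    obtain ⟨k, hk⟩ := M.toCoxeterSystem.exists_rightDescent_of_ne_one hx1
    by_cases hki : k = i
    · rwa [← hki]
    · exact absurd rfl (mem_of_isRightDescent (hx k hki) hk)
  by_contra! hcon
  have h1 := key w h hcon.1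
  have h2 := key (w * M.simple i)
    (fun j hj => mul_mem (h j hj) (M.simple_mem_maxParabolic (Ne.symm hj))) fun h0 => by
      apply hcon.2
      rw [← M.mul_simple_mul_simple w i, h0, one_mul]
  exact (M.toCoxeterSystem.isRightDescent_iff_not_isRightDescent_mul.1 h1) h2

/-- A finite rank 2 standard parabolic subgroup has a longest element. -/
theorem exists_isRightDescent_pair {i j : B} (hM : M i j ≠ 0) :
    ∃ w ∈ Subgroup.closure (M.simple '' {i, j}), M.toCoxeterSystem.IsRightDescent w i ∧
      M.toCoxeterSystem.IsRightDescent w j := by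
  set r := M.simple i * M.simple j with hr
  have hfin : IsOfFinOrder r :=
    isOfFinOrder_iff_pow_eq_one.2 ⟨M i j, Nat.pos_of_ne_zero hM,
      M.toCoxeterSystem.simple_mul_simple_pow i j⟩
  have hz : (Subgroup.zpowers r : Set M.Group).Finite := finite_zpowers.2 hfin
  -- Every element of the dihedral group has the form `r ^ k` or `r ^ k * s i`.
  have hsub : ((Subgroup.closure (M.simple '' {i, j}) : Subgroup M.Group) : Set M.Group) ⊆
      (Subgroup.zpowers r : Set M.Group) ∪ (fun x => x * M.simple i) '' Subgroup.zpowers r := by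
    have step : ∀ x ∈ (Subgroup.zpowers r : Set M.Group) ∪
        (fun x => x * M.simple i) '' Subgroup.zpowers r, ∀ y ∈ M.simple '' {i, j},
        x * y ∈ (Subgroup.zpowers r : Set M.Group) ∪
        (fun x => x * M.simple i) '' Subgroup.zpowers r := by
      have hrinv : r⁻¹ = M.simple j * M.simple i := by
        rw [hr, mul_inv_rev, simple_inv, simple_inv]
      rintro x (hx | ⟨z, hz, rfl⟩) y ⟨k, rfl | rfl, rfl⟩
      · exact Or.inr ⟨x, hx, rfl⟩
      · refine Or.inr ⟨x * r⁻¹, mul_mem hx (inv_mem (Subgroup.mem_zpowers r)), ?_⟩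
        simp only [hrinv, mul_assoc, simple_mul_self, mul_one]
      · refine Or.inl ?_
        simp only [mul_simple_mul_simple]
        exact hz
      · refine Or.inl ?_
        simp only [mul_assoc]
        exact mul_mem hz (Subgroup.mem_zpowers r)
    intro x hx
    induction hx using Subgroup.closure_induction_right with
    | one => exact Or.inl (one_mem _)
    | mul_right x hx y hy ih => exact step x ih y hy
    | mul_inv_cancel x hx y hy ih =>
      obtain ⟨k, hk, rfl⟩ := hy
      rw [simple_inv]
      exact step x ih _ ⟨k, hk, rfl⟩
  have hfinite := (hz.union (hz.image _)).subset hsub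
  obtain ⟨w, hw, hmax⟩ := hfinite.exists_maximalFor M.len _ ⟨1, one_mem _⟩
  have hdesc : ∀ k ∈ ({i, j} : Set B), M.toCoxeterSystem.IsRightDescent w k := by
    intro k hk
    by_contra hn
    have h1 := M.toCoxeterSystem.not_isRightDescent_iff.1 hn
    have hmem : w * M.simple k ∈ Subgroup.closure (M.simple '' {i, j}) :=
      mul_mem hw (Subgroup.subset_closure ⟨k, hk, rfl⟩)
    have h2 : M.len w ≤ M.len (w * M.simple k) := by
      have : M.len (w * M.simple k) = M.len w + 1 := h1
      omega
    have h3 : M.len (w * M.simple k) ≤ M.len w := hmax hmem h2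
    have : M.len (w * M.simple k) = M.len w + 1 := h1
    omega
  exact ⟨w, hw, hdesc i (by simp), hdesc j (by simp)⟩

/-- An isometry between the chamber systems of two Coxeter groups respects the types of the edges
along an edge of type `j`, as far as edges of a type `i` with `M i j` finite are concerned. Indeed,
with the longest element `w₀` of the parabolic subgroup generated by `i` and `j`, the edges of
types `i` and `j` at `w` both approach `w * w₀⁻¹`. This is preserved by the isometry, so that the
exchange condition in the target yields a chamber at distance 2 from `ψ w`, which can only come
from `w * s j * s i`. -/
theorem isometry_mul_simple {B' : Type*} {M' : CoxeterMatrix B'} (ψ : M.Group ≃ M'.Group)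
    (hψ : ∀ w w', M'.len ((ψ w)⁻¹ * ψ w') = M.len (w⁻¹ * w')) {i j : B} (hij : i ≠ j)
    (hM : M i j ≠ 0) {w : M.Group} {a b : B'} (ha : ψ (w * M.simple i) = ψ w * M'.simple a)
    (hb : ψ (w * M.simple j) = ψ w * M'.simple b) :
    ψ (w * M.simple j * M.simple i) = ψ w * M'.simple b * M'.simple a := by
  obtain ⟨w₀, hw₀, hi, hj⟩ := exists_isRightDescent_pair hM
  have hab : M'.simple a ≠ M'.simple b := by
    intro h
    rw [← h, ← ha] at hb
    exact hij (M.simple_injective (mul_left_cancel (ψ.injective hb))).symm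
  have hD : ∀ x, M'.len ((ψ (w * w₀⁻¹))⁻¹ * ψ x) = M.len (w₀ * (w⁻¹ * x)) := by
    intro x; rw [hψ]; congr 1; group
  have hy : M'.len ((ψ (w * w₀⁻¹))⁻¹ * ψ w) = M.len w₀ := by rw [hD]; simp
  have ha' : M'.toCoxeterSystem.IsRightDescent ((ψ (w * w₀⁻¹))⁻¹ * ψ w) a := by
    have h1 : M'.len ((ψ (w * w₀⁻¹))⁻¹ * ψ w * M'.simple a) = M.len (w₀ * M.simple i) := by
      rw [mul_assoc, ← ha, hD]; simp
    have h2 : M.len (w₀ * M.simple i) < M.len w₀ := hi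
    rw [← hy, ← h1] at h2
    exact h2
  have hyb : M'.len ((ψ (w * w₀⁻¹))⁻¹ * ψ w * M'.simple b) = M.len (w₀ * M.simple j) := by
    rw [mul_assoc, ← hb, hD]; simp
  have hb' : M'.toCoxeterSystem.IsRightDescent ((ψ (w * w₀⁻¹))⁻¹ * ψ w) b := by
    have h2 : M.len (w₀ * M.simple j) < M.len w₀ := hj
    rw [← hy, ← hyb] at h2
    exact h2
  have hab' := CoxeterSystem.IsRightDescent.mul_simple _ ha' hb' hab
  obtain ⟨z, hz⟩ := ψ.surjective (ψ w * M'.simple b * M'.simple a)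
  have hz1 : M.len ((w * M.simple j)⁻¹ * z) = 1 := by
    rw [← hψ, hz, hb]
    have : (ψ w * M'.simple b)⁻¹ * (ψ w * M'.simple b * M'.simple a) = M'.simple a := by group
    rw [this]
    exact M'.toCoxeterSystem.length_simple a
  obtain ⟨k, hk⟩ := M.toCoxeterSystem.length_eq_one_iff.1 hz1
  have hzk : z = w * M.simple j * M.simple k := by
    rw [inv_mul_eq_iff_eq_mul] at hk; exact hk
  have hkd : M.toCoxeterSystem.IsRightDescent (w₀ * M.simple j) k := by
    have h1 : M'.len ((ψ (w * w₀⁻¹))⁻¹ * ψ w * M'.simple b * M'.simple a) <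
      M'.len ((ψ (w * w₀⁻¹))⁻¹ * ψ w * M'.simple b) := hab'
    have h2 : (ψ (w * w₀⁻¹))⁻¹ * ψ w * M'.simple b * M'.simple a = (ψ (w * w₀⁻¹))⁻¹ * ψ z := by
      rw [hz]; group
    have h3 : w₀ * (w⁻¹ * z) = w₀ * M.simple j * M.simple k := by rw [hzk]; group
    rw [hyb, h2, hD, h3] at h1
    exact h1
  have hkmem : k ∈ ({i, j} : Set B) :=
    mem_of_isRightDescent (mul_mem hw₀ (Subgroup.subset_closure ⟨j, by simp, rfl⟩)) hkd
  rcases hkmem with rfl | rfl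
  · rw [← hzk, hz]
  · exact absurd hkd (M.toCoxeterSystem.isRightDescent_iff_not_isRightDescent_mul.1 hj)

end CoxeterMatrix

/-! ### Charts of Coxeter complexes -/

section Charts

open scoped Classical

namespace SimplexComplex

variable {V V' : Type*} {B : Type*}

theorem mem_vertices_of_mem {K : SimplexComplex V} {s : Finset V} (hs : s ∈ K.faces) {v : V}
    (hv : v ∈ s) : v ∈ K.vertices :=
  K.down_closed s hs _ (Finset.singleton_subset_iff.2 hv)

/-- A chart of a complex `K`: a labelling of `K` as the Coxeter complex of `M`, where `vert w i` is
the vertex of type `i` of the chamber belonging to `w`. -/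
structure Chart (K : SimplexComplex V) (M : CoxeterMatrix B) where
  vert : M.Group → B → V
  vert_eq_iff : ∀ w w' i j, vert w i = vert w' j ↔ i = j ∧ w⁻¹ * w' ∈ M.maxParabolic i
  mem_faces : ∀ s, s ∈ K.faces ↔ ∃ w, ∀ v ∈ s, ∃ i, v = vert w i

namespace Chart

/-- The tautological chart of a Coxeter complex. -/
def self (M : CoxeterMatrix B) : Chart M.coxeterComplex M where
  vert w i := ⟨i, w⟩
  vert_eq_iff w w' i j := by
    constructor
    · intro h
      obtain ⟨rfl, h⟩ := Sigma.mk.inj_iff.1 h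
      exact ⟨rfl, QuotientGroup.eq.1 (eq_of_heq h)⟩
    · rintro ⟨rfl, h⟩
      rw [QuotientGroup.eq.2 h]
  mem_faces s := by
    refine exists_congr fun w => forall₂_congr fun v _ => ?_
    constructor
    · intro h
      exact ⟨v.1, by rw [← h]⟩
    · rintro ⟨i, rfl⟩
      rfl

variable {K : SimplexComplex V} {L : SimplexComplex V'} {M : CoxeterMatrix B}

theorem vert_mem_vertices (κ : Chart K M) (w : M.Group) (i : B) : κ.vert w i ∈ K.vertices :=
  (κ.mem_faces _).2 ⟨w, fun _ hv => ⟨i, Finset.mem_singleton.1 hv⟩⟩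

/-- The pullback of a chart along a simplicial isomorphism. -/
def comap (κ : Chart L M) (e : Iso K L) : Chart K M where
  vert w i := (e.toEquiv.symm ⟨κ.vert w i, κ.vert_mem_vertices w i⟩).1
  vert_eq_iff w w' i j := by
    rw [← κ.vert_eq_iff, Subtype.val_inj, e.toEquiv.symm.injective.eq_iff, Subtype.mk.injEq]
  mem_faces s := by
    have key : ∀ t : Finset K.vertices, t.map (Function.Embedding.subtype _) ∈ K.faces ↔
        ∃ w, ∀ v ∈ t, ∃ i, v = e.toEquiv.symm ⟨κ.vert w i, κ.vert_mem_vertices w i⟩ := by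
      intro t
      rw [e.map_faces, κ.mem_faces]
      refine exists_congr fun w => ?_
      simp only [Equiv.eq_symm_apply, Subtype.ext_iff]
      rw [Finset.forall_mem_map, Finset.forall_mem_map]
      rfl
    by_cases hs : ∀ v ∈ s, v ∈ K.vertices
    · have h := key (s.subtype (· ∈ K.vertices))
      rw [show (s.subtype (· ∈ K.vertices)).map (Function.Embedding.subtype _) = s from
        Finset.subtype_map_of_mem hs] at h
      rw [h]
      refine exists_congr fun w => ⟨fun h v hv => ?_, fun h v hv => ?_⟩
      · obtain ⟨i, hi⟩ := h ⟨v, hs v hv⟩ (by simpa using hv)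
        exact ⟨i, congrArg Subtype.val hi⟩
      · obtain ⟨i, hi⟩ := h v.1 (by simpa using hv)
        exact ⟨i, Subtype.ext hi⟩
    · refine iff_of_false (fun h => hs fun v hv => mem_vertices_of_mem h hv) ?_
      rintro ⟨w, h⟩
      apply hs
      intro v hv
      obtain ⟨i, rfl⟩ := h v hv
      exact Subtype.property _

variable [Fintype B] (κ : Chart K M)

/-- The chamber of a chart that belongs to a group element. -/
def chamber (w : M.Group) : Finset V :=
  Finset.univ.map ⟨κ.vert w, fun _ _ h => ((κ.vert_eq_iff _ _ _ _).1 h).1⟩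

theorem mem_chamber {w : M.Group} {v : V} : v ∈ κ.chamber w ↔ ∃ i, κ.vert w i = v := by
  rw [chamber, Finset.mem_map]
  simp only [Finset.mem_univ, true_and]
  rfl

theorem vert_mem_chamber_self (w : M.Group) (i : B) : κ.vert w i ∈ κ.chamber w :=
  κ.mem_chamber.2 ⟨i, rfl⟩

omit [Fintype B] in
theorem vert_injective (w : M.Group) : Function.Injective (κ.vert w) :=
  fun _ _ h => ((κ.vert_eq_iff _ _ _ _).1 h).1

theorem card_chamber (w : M.Group) : (κ.chamber w).card = Fintype.card B := by
  simp [chamber]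

theorem vert_mem_chamber {w w' : M.Group} {i : B} :
    κ.vert w i ∈ κ.chamber w' ↔ w⁻¹ * w' ∈ M.maxParabolic i := by
  rw [mem_chamber]
  constructor
  · rintro ⟨j, hj⟩
    exact ((κ.vert_eq_iff _ _ _ _).1 hj.symm).2
  · intro h
    exact ⟨i, ((κ.vert_eq_iff _ _ _ _).2 ⟨rfl, h⟩).symm⟩

/-- A vertex has the same type in all the chambers containing it. -/
theorem vert_eq_of_mem {w w' : M.Group} {i : B} (h : κ.vert w i ∈ κ.chamber w') :
    κ.vert w' i = κ.vert w i :=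
  ((κ.vert_eq_iff _ _ _ _).2 ⟨rfl, κ.vert_mem_chamber.1 h⟩).symm

theorem mem_faces_iff {s : Finset V} : s ∈ K.faces ↔ ∃ w, s ⊆ κ.chamber w := by
  rw [κ.mem_faces]
  refine exists_congr fun w => forall₂_congr fun v _ => ?_
  rw [mem_chamber]
  simp only [eq_comm]

theorem chamber_injective : Function.Injective κ.chamber := by
  intro w w' h
  rw [← inv_mul_eq_one]
  apply CoxeterMatrix.eq_one_of_forall_mem_maxParabolic
  intro i
  rw [← κ.vert_mem_chamber, ← h]
  exact κ.vert_mem_chamber_self w i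

theorem chamber_mem_faces (w : M.Group) : κ.chamber w ∈ K.faces :=
  κ.mem_faces_iff.2 ⟨w, subset_rfl⟩

theorem chamber_mem_chambers (w : M.Group) : κ.chamber w ∈ K.chambers := by
  refine ⟨κ.chamber_mem_faces w, fun s hs hws => ?_⟩
  obtain ⟨w', hw'⟩ := κ.mem_faces_iff.1 hs
  have : κ.chamber w = κ.chamber w' := Finset.eq_of_subset_of_card_le (hws.trans hw')
    (by rw [card_chamber, card_chamber])
  rw [this]
  exact hw'

theorem exists_chamber_eq {C : Finset V} (hC : C ∈ K.chambers) : ∃ w, κ.chamber w = C := by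
  obtain ⟨w, hw⟩ := κ.mem_faces_iff.1 hC.1
  have hmax : Maximal (fun s => s ∈ K.faces) C := hC
  exact ⟨w, (hmax.eq_of_le (κ.chamber_mem_faces w) hw).symm⟩

theorem card_chamber_erase (w : M.Group) (i : B) :
    ((κ.chamber w).erase (κ.vert w i)).card + 1 = Fintype.card B := by
  rw [Finset.card_erase_add_one (κ.vert_mem_chamber_self w i), card_chamber]

theorem exists_eq_erase {w : M.Group} {P : Finset V} (hP : P ⊆ κ.chamber w)
    (hcard : P.card + 1 = Fintype.card B) : ∃ i, P = (κ.chamber w).erase (κ.vert w i) := by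
  rw [← κ.card_chamber w] at hcard
  obtain ⟨a, ha, h⟩ := Finset.exists_eq_insert_iff.2 ⟨hP, hcard⟩
  obtain ⟨i, rfl⟩ := κ.mem_chamber.1 (h ▸ Finset.mem_insert_self a P)
  exact ⟨i, by rw [← h, Finset.erase_insert ha]⟩

/-- A panel of a Coxeter complex is contained in exactly two chambers. -/
theorem erase_subset_chamber_iff {w w' : M.Group} {i : B} :
    (κ.chamber w).erase (κ.vert w i) ⊆ κ.chamber w' ↔ w' = w ∨ w' = w * M.simple i := by
  constructor
  · intro h
    have := CoxeterMatrix.eq_one_or_eq_simple (w := w⁻¹ * w') (i := i) fun j hj => by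
      rw [← κ.vert_mem_chamber]
      exact h (Finset.mem_erase.2 ⟨fun h => hj (κ.vert_injective w h),
        κ.vert_mem_chamber_self w j⟩)
    rcases this with h1 | h1
    · exact Or.inl (inv_mul_eq_one.1 h1).symm
    · exact Or.inr (inv_mul_eq_iff_eq_mul.1 h1)
  · rintro (rfl | rfl)
    · exact Finset.erase_subset _ _
    · intro v hv
      rw [Finset.mem_erase, mem_chamber] at hv
      obtain ⟨hj, j, rfl⟩ := hv
      rw [vert_mem_chamber, inv_mul_cancel_left]
      exact M.simple_mem_maxParabolic fun h => hj (by rw [h])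

omit [Fintype B] in
theorem mul_simple_ne (w : M.Group) (i : B) : w * M.simple i ≠ w :=
  fun h => M.simple_ne_one i (mul_eq_left.1 h)

theorem vert_mul_simple (w : M.Group) {i j : B} (h : j ≠ i) :
    κ.vert (w * M.simple i) j = κ.vert w j :=
  κ.vert_eq_of_mem <| by
    rw [vert_mem_chamber, inv_mul_cancel_left]
    exact M.simple_mem_maxParabolic h.symm

theorem vert_notMem_chamber_mul_simple (w : M.Group) (i : B) :
    κ.vert w i ∉ κ.chamber (w * M.simple i) := by
  intro h
  have : κ.chamber w ⊆ κ.chamber (w * M.simple i) := by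
    rw [← Finset.insert_erase (κ.vert_mem_chamber_self w i), Finset.insert_subset_iff]
    exact ⟨h, κ.erase_subset_chamber_iff.2 (Or.inr rfl)⟩
  have := Finset.eq_of_subset_of_card_le this (by rw [card_chamber, card_chamber])
  exact mul_simple_ne w i (κ.chamber_injective this).symm

/-- Two different chambers of a Coxeter complex that contain a common panel belong to group elements
that differ by a simple reflection. -/
theorem exists_mul_simple {w w' : M.Group} {P : Finset V} (hw : P ⊆ κ.chamber w)
    (hw' : P ⊆ κ.chamber w') (hcard : P.card + 1 = Fintype.card B) :
    w' = w ∨ ∃ i, w' = w * M.simple i ∧ P = (κ.chamber w).erase (κ.vert w i) := by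
  obtain ⟨i, rfl⟩ := κ.exists_eq_erase hw hcard
  exact (κ.erase_subset_chamber_iff.1 hw').imp id fun h => ⟨i, h, rfl⟩

/-- A chart is determined by its labelling of the vertices of one chamber. -/
theorem vert_eq_of_vert_eq {κ κ' : Chart K M} {w₀ : M.Group}
    (h : ∀ i, κ.vert w₀ i = κ'.vert w₀ i) (w : M.Group) (i : B) : κ.vert w i = κ'.vert w i := by
  suffices H : ∀ u : M.Group, ∀ i, κ.vert (w₀ * u) i = κ'.vert (w₀ * u) i by
    simpa using H (w₀⁻¹ * w) i
  intro u
  induction u using M.toCoxeterSystem.simple_induction_right with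
  | one => simpa using h
  | mul_simple_right u k ih =>
    rw [M.toCoxeterSystem_simple, ← mul_assoc]
    set x := w₀ * u
    have hx : κ.chamber x = κ'.chamber x := by
      ext v; rw [mem_chamber, mem_chamber]; simp only [ih]
    obtain ⟨y, hy⟩ := κ'.exists_chamber_eq (κ.chamber_mem_chambers (x * M.simple k))
    have hsub : (κ'.chamber x).erase (κ'.vert x k) ⊆ κ'.chamber y := by
      rw [← hx, ← ih, hy]
      exact κ.erase_subset_chamber_iff.2 (Or.inr rfl)
    have hyx : κ'.chamber (x * M.simple k) = κ.chamber (x * M.simple k) := by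
      rcases κ'.erase_subset_chamber_iff.1 hsub with rfl | rfl
      · rw [← hx] at hy
        exact absurd (κ.chamber_injective hy).symm (mul_simple_ne x k)
      · exact hy
    have hne : ∀ j ≠ k, κ.vert (x * M.simple k) j = κ'.vert (x * M.simple k) j := by
      intro j hj
      rw [vert_mul_simple _ _ hj, vert_mul_simple _ _ hj, ih]
    intro j
    by_cases hj : j = k
    · subst hj
      obtain ⟨l, hl⟩ := κ'.mem_chamber.1 (hyx ▸ κ.vert_mem_chamber_self (x * M.simple j) j)
      by_cases hlj : l = j
      · rw [← hl, hlj]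
      · rw [← hne l hlj] at hl
        exact absurd (κ.vert_injective _ hl) hlj
    · exact hne j hj

end Chart
end SimplexComplex
end Charts

/-! ### Retractions of buildings -/

section Buildings

open scoped Classical

namespace SimplexComplex

variable {V : Type*} {B : Type*}

theorem Chart.comap_vert_of_fixed {K L : SimplexComplex V} {M : CoxeterMatrix B} (κ : Chart L M)
    (e : Iso K L) {w : M.Group} {i : B} (hv : κ.vert w i ∈ K.vertices)
    (he : (e.toEquiv ⟨κ.vert w i, hv⟩).1 = κ.vert w i) : (κ.comap e).vert w i = κ.vert w i := by
  have : e.toEquiv.symm ⟨κ.vert w i, κ.vert_mem_vertices w i⟩ = ⟨κ.vert w i, hv⟩ := by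
    rw [Equiv.symm_apply_eq]
    exact Subtype.ext he.symm
  exact congrArg Subtype.val this

/-- The graph on the chambers of a complex given by adjacency. -/
def chamberGraph (Δ : SimplexComplex V) : SimpleGraph Δ.chambers where
  Adj := Δ.Adjacent
  symm := ⟨fun _ _ h => ⟨h.1.symm, h.2.imp fun _ hP => ⟨hP.1, hP.2.2, hP.2.1⟩⟩⟩
  loopless := ⟨fun _ h => h.1 rfl⟩

theorem Adjacent.symm {Δ : SimplexComplex V} {C D : Δ.chambers} (h : Δ.Adjacent C D) :
    Δ.Adjacent D C :=
  SimpleGraph.Adj.symm (G := Δ.chamberGraph) h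

/-- The gallery distance between two chambers. -/
noncomputable abbrev dist {Δ : SimplexComplex V} (C D : Δ.chambers) : ℕ := Δ.chamberGraph.dist C D

theorem dist_comm {Δ : SimplexComplex V} (C D : Δ.chambers) : dist C D = dist D C :=
  SimpleGraph.dist_comm

theorem dist_eq_one {Δ : SimplexComplex V} {C D : Δ.chambers} : dist C D = 1 ↔ Δ.Adjacent C D :=
  SimpleGraph.dist_eq_one_iff_adj

namespace IsApartmentSystem

variable {Δ : SimplexComplex V} {𝓐 : Set (SimplexComplex V)} (h : Δ.IsApartmentSystem 𝓐)

include h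

/-- All apartments of a building have charts with the same Coxeter matrix. -/
theorem exists_charts : ∃ (n : ℕ) (M : CoxeterMatrix (Fin n)), ∀ K ∈ 𝓐, Nonempty (Chart K M) := by
  obtain ⟨K, hK, -⟩ := h.exists_apartment ∅ Δ.empty_mem ∅ Δ.empty_mem
  obtain ⟨n, M, ⟨e⟩⟩ := h.isCoxeterComplex K hK
  refine ⟨n, M, fun L hL => ?_⟩
  obtain ⟨f, -⟩ := h.exists_iso L hL K hK ∅ ∅ L.empty_mem L.empty_mem K.empty_mem K.empty_mem
  exact ⟨((Chart.self M).comap e).comap f⟩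

variable [Fintype B] {M : CoxeterMatrix B} (hM : ∀ K ∈ 𝓐, Nonempty (Chart K M))

theorem mem_chambers_iff {K : SimplexComplex V} (hK : K ∈ 𝓐) {C : Finset V} :
    C ∈ K.chambers ↔ C ∈ K.faces ∧ C ∈ Δ.chambers := by
  constructor
  · refine fun hC => ⟨hC.1, h.le K hK hC.1, fun A hA hCA => ?_⟩
    obtain ⟨L, hL, hAL, -⟩ := h.exists_apartment A hA A hA
    have hCL := L.down_closed A hAL C hCA
    obtain ⟨e, he⟩ := h.exists_iso K hK L hL C C hC.1 hC.1 hCL hCL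
    -- The image of `C` in `L` is `C` itself, so that `C` is a maximal simplex of `L`.
    obtain ⟨n, N, ⟨f⟩⟩ := h.isCoxeterComplex L hL
    let ν := (Chart.self N).comap f
    obtain ⟨w, hw⟩ := (ν.comap e).exists_chamber_eq hC
    have hsub : C ⊆ ν.chamber w := by
      intro v hv
      have hv' := hv
      rw [← hw, Chart.mem_chamber] at hv'
      obtain ⟨i, rfl⟩ := hv'
      rw [Chart.mem_chamber]
      refine ⟨i, ?_⟩
      have h1 := he ⟨_, mem_vertices_of_mem hC.1 hv⟩ (Or.inl hv)
      refine Eq.trans ?_ h1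
      exact congrArg Subtype.val (Equiv.apply_symm_apply _ _).symm
    have hcard : C.card = (ν.chamber w).card := by
      rw [← hw, Chart.card_chamber, Chart.card_chamber]
    have hCw := Finset.eq_of_subset_of_card_le hsub hcard.ge
    have hmax : C ∈ L.chambers := hCw ▸ ν.chamber_mem_chambers w
    exact hmax.2 hAL hCA
  · rintro ⟨hC, hCΔ⟩
    exact ⟨hC, fun A hA hCA => hCΔ.2 (h.le K hK hA) hCA⟩

theorem exists_apartment_chambers (C D : Δ.chambers) :
    ∃ K ∈ 𝓐, C.1 ∈ K.chambers ∧ D.1 ∈ K.chambers := by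
  obtain ⟨K, hK, hC, hD⟩ := h.exists_apartment C.1 C.2.1 D.1 D.2.1
  exact ⟨K, hK, (h.mem_chambers_iff hK).2 ⟨hC, C.2⟩, (h.mem_chambers_iff hK).2 ⟨hD, D.2⟩⟩

include hM

theorem card_eq (C : Δ.chambers) : C.1.card = Fintype.card B := by
  obtain ⟨K, hK, hC, -⟩ := h.exists_apartment_chambers C C
  obtain ⟨κ⟩ := hM K hK
  obtain ⟨w, hw⟩ := κ.exists_chamber_eq hC
  rw [← hw, κ.card_chamber]

theorem exists_subset_chamber {s : Finset V} (hs : s ∈ Δ.faces) : ∃ C : Δ.chambers, s ⊆ C.1 := by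
  obtain ⟨K, hK, hsK, -⟩ := h.exists_apartment s hs s hs
  obtain ⟨κ⟩ := hM K hK
  obtain ⟨w, hw⟩ := κ.mem_faces_iff.1 hsK
  exact ⟨⟨κ.chamber w, ((h.mem_chambers_iff hK).1 (κ.chamber_mem_chambers w)).2⟩, hw⟩

theorem isPanel_iff {P : Finset V} (C : Δ.chambers) (hP : P ⊆ C.1) :
    Δ.IsPanel P ↔ P.card + 1 = Fintype.card B := by
  constructor
  · rintro ⟨D, hD, -, hPD⟩
    rw [hPD, h.card_eq hM ⟨D, hD⟩]
  · intro hc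
    exact ⟨C.1, C.2, hP, by rw [hc, h.card_eq hM]⟩

theorem _root_.SimplexComplex.IsPanel.card_add_one {P : Finset V} (hP : Δ.IsPanel P) :
    P.card + 1 = Fintype.card B := by
  obtain ⟨C, hC, hPC, -⟩ := id hP
  exact (h.isPanel_iff hM ⟨C, hC⟩ hPC).1 hP

theorem eq_inter {P : Finset V} (hP : Δ.IsPanel P) {C D : Δ.chambers} (hCD : C ≠ D)
    (hC : P ⊆ C.1) (hD : P ⊆ D.1) : P = C.1 ∩ D.1 := by
  apply Finset.eq_of_subset_of_card_le (Finset.subset_inter hC hD)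
  have h1 := hP.card_add_one h hM
  by_contra hlt
  have h2 : C.1 ∩ D.1 = C.1 := Finset.eq_of_subset_of_card_le Finset.inter_subset_left
    (by rw [h.card_eq hM]; omega)
  have h3 : C.1 = D.1 := Finset.eq_of_subset_of_card_le (Finset.inter_eq_left.1 h2)
    (by rw [h.card_eq hM, h.card_eq hM])
  exact hCD (Subtype.ext h3)

theorem adjacent_iff {C D : Δ.chambers} :
    Δ.Adjacent C D ↔ C ≠ D ∧ Δ.IsPanel (C.1 ∩ D.1) := by
  constructor
  · rintro ⟨hne, P, hP, hC, hD⟩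
    exact ⟨hne, h.eq_inter hM hP hne hC hD ▸ hP⟩
  · rintro ⟨hne, hP⟩
    exact ⟨hne, _, hP, Finset.inter_subset_left, Finset.inter_subset_right⟩

omit hM in
/-- The chamber of a building given by a chart of an apartment. -/
def chamberOf {K : SimplexComplex V} (hK : K ∈ 𝓐) (κ : Chart K M) (w : M.Group) : Δ.chambers :=
  ⟨κ.chamber w, ((h.mem_chambers_iff hK).1 (κ.chamber_mem_chambers w)).2⟩

omit hM in
theorem exists_chamberOf_eq {K : SimplexComplex V} (hK : K ∈ 𝓐) (κ : Chart K M) {C : Δ.chambers}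
    (hC : C.1 ∈ K.chambers) : ∃ w, C = h.chamberOf hK κ w := by
  obtain ⟨w, hw⟩ := κ.exists_chamber_eq hC
  exact ⟨w, Subtype.ext hw.symm⟩

omit hM in
theorem chamberOf_injective {K : SimplexComplex V} (hK : K ∈ 𝓐) (κ : Chart K M) :
    Function.Injective (h.chamberOf hK κ) :=
  fun _ _ hw => κ.chamber_injective (congrArg Subtype.val hw)

omit hM in
theorem chamberOf_mem {K : SimplexComplex V} (hK : K ∈ 𝓐) (κ : Chart K M) (w : M.Group) :
    (h.chamberOf hK κ w).1 ∈ K.chambers :=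
  κ.chamber_mem_chambers w

omit hM in
/-- Charts of two apartments that agree on a common chamber agree on the intersection. -/
theorem vert_eq_of_common {L L' : SimplexComplex V} (hL : L ∈ 𝓐) (hL' : L' ∈ 𝓐)
    (κ : Chart L M) (κ' : Chart L' M) {w₀ : M.Group} (h₀ : ∀ i, κ.vert w₀ i = κ'.vert w₀ i)
    {A : Finset V} (hA : A ∈ L.faces) (hA' : A ∈ L'.faces) {w : M.Group} {i : B}
    (hv : κ.vert w i ∈ A) : κ'.vert w i = κ.vert w i := by
  have hC : κ.chamber w₀ = κ'.chamber w₀ := by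
    ext v; rw [Chart.mem_chamber, Chart.mem_chamber]; simp only [h₀]
  obtain ⟨e, he⟩ := h.exists_iso L hL L' hL' A (κ.chamber w₀) hA (κ.chamber_mem_faces w₀) hA'
    (hC ▸ κ'.chamber_mem_faces w₀)
  have h1 : ∀ j, κ.vert w₀ j = (κ'.comap e).vert w₀ j := by
    intro j
    have hj : κ'.vert w₀ j ∈ L.vertices := by rw [← h₀]; exact κ.vert_mem_vertices _ _
    rw [κ'.comap_vert_of_fixed e hj, h₀]
    exact he _ (Or.inr (by rw [hC]; exact κ'.vert_mem_chamber_self w₀ j))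
  have h2 := Chart.vert_eq_of_vert_eq h1 w i
  have h3 := he ⟨_, κ.vert_mem_vertices w i⟩ (Or.inl hv)
  refine Eq.trans ?_ h3
  have h4 : (⟨κ.vert w i, κ.vert_mem_vertices w i⟩ : L.vertices) =
      e.toEquiv.symm ⟨κ'.vert w i, κ'.vert_mem_vertices w i⟩ := Subtype.ext h2
  rw [h4, Equiv.apply_symm_apply]

/-- The retraction of a building onto an apartment `K` centered at one of its chambers, written in
terms of a chart of `K`. It exists because charts that agree on the center agree on intersections
of apartments. -/
theorem exists_retraction {K : SimplexComplex V} (hK : K ∈ 𝓐) (κ : Chart K M) (w₀ : M.Group) :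
    ∃ r : Δ.chambers → M.Group,
      (∀ w, r (h.chamberOf hK κ w) = w) ∧
      (∀ X, r X = w₀ → X = h.chamberOf hK κ w₀) ∧
      (∀ X : Δ.chambers, X.1 ∩ κ.chamber w₀ ⊆ κ.chamber (r X)) ∧
      (∀ X Y, Δ.Adjacent X Y → r Y = r X ∨ ∃ i, r Y = r X * M.simple i) := by
  have hr : ∀ X : Δ.chambers, ∃ w, ∃ L ∈ 𝓐, ∃ μ : Chart L M,
      (∀ i, μ.vert w₀ i = κ.vert w₀ i) ∧ μ.chamber w = X.1 := by
    intro X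
    obtain ⟨L, hL, hCL, hXL⟩ := h.exists_apartment_chambers (h.chamberOf hK κ w₀) X
    obtain ⟨e, he⟩ := h.exists_iso L hL K hK (κ.chamber w₀) (κ.chamber w₀) hCL.1 hCL.1
      (κ.chamber_mem_faces w₀) (κ.chamber_mem_faces w₀)
    obtain ⟨w, hw⟩ := (κ.comap e).exists_chamber_eq hXL
    refine ⟨w, L, hL, κ.comap e, fun i => ?_, hw⟩
    have hi := κ.vert_mem_chamber_self w₀ i
    exact κ.comap_vert_of_fixed e (mem_vertices_of_mem hCL.1 hi) (he _ (Or.inl hi))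
  choose r L hL μ hμ hrX using hr
  refine ⟨r, fun w => ?_, fun X hX => ?_, fun X v hv => ?_, fun X Y hXY => ?_⟩
  · set X := h.chamberOf hK κ w
    have hX : X.1 ∈ (L X).faces := by rw [← hrX]; exact (μ X).chamber_mem_faces _
    have : κ.chamber w ⊆ (μ X).chamber w := by
      intro v hv
      obtain ⟨i, rfl⟩ := κ.mem_chamber.1 hv
      rw [← h.vert_eq_of_common hK (hL X) κ (μ X) (fun i => (hμ X i).symm)
        (κ.chamber_mem_faces w) hX hv]
      exact (μ X).vert_mem_chamber_self w i
    have h2 := Finset.eq_of_subset_of_card_le this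
      (by rw [Chart.card_chamber, Chart.card_chamber])
    exact (μ X).chamber_injective ((hrX X).trans h2)
  · apply Subtype.ext
    rw [← hrX, hX]
    ext v
    change _ ↔ v ∈ κ.chamber w₀
    rw [Chart.mem_chamber, Chart.mem_chamber]; simp only [hμ]
  · rw [Finset.mem_inter] at hv
    obtain ⟨i, rfl⟩ := κ.mem_chamber.1 hv.2
    rw [← hrX, ← hμ X, Chart.vert_mem_chamber] at hv
    rw [Chart.vert_mem_chamber]
    exact hv.1
  · obtain ⟨-, P, hP, hPX, hPY⟩ := hXY
    have hPX' : P ⊆ (μ X).chamber (r X) := by rw [hrX]; exact hPX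
    have hPY' : P ⊆ (μ Y).chamber (r Y) := by rw [hrX]; exact hPY
    have hPL : P ∈ (L X).faces := (μ X).mem_faces_iff.2 ⟨_, hPX'⟩
    have hPL' : P ∈ (L Y).faces := (μ Y).mem_faces_iff.2 ⟨_, hPY'⟩
    have hPY'' : P ⊆ (μ X).chamber (r Y) := by
      intro v hv
      obtain ⟨i, rfl⟩ := (μ Y).mem_chamber.1 (hPY' hv)
      rw [← h.vert_eq_of_common (hL Y) (hL X) (μ Y) (μ X)
        (fun i => by rw [hμ, hμ]) hPL' hPL hv]
      exact (μ X).vert_mem_chamber_self _ i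
    exact ((μ X).exists_mul_simple hPX' hPY'' (hP.card_add_one h hM)).imp id
      fun ⟨i, hi⟩ => ⟨i, hi.1⟩

end IsApartmentSystem
end SimplexComplex
end Buildings

/-! ### The gallery distance -/

section Buildings

open scoped Classical

namespace SimplexComplex
namespace IsApartmentSystem

variable {V B : Type*} [Fintype B] {Δ : SimplexComplex V} {𝓐 : Set (SimplexComplex V)}
  (h : Δ.IsApartmentSystem 𝓐) {M : CoxeterMatrix B} (hM : ∀ K ∈ 𝓐, Nonempty (Chart K M))

include h hM

theorem adjacent_chamberOf {K : SimplexComplex V} (hK : K ∈ 𝓐) (κ : Chart K M) {w w' : M.Group} :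
    Δ.Adjacent (h.chamberOf hK κ w) (h.chamberOf hK κ w') ↔ ∃ i, w' = w * M.simple i := by
  constructor
  · rintro ⟨hne, P, hP, hw, hw'⟩
    rcases κ.exists_mul_simple hw hw' (hP.card_add_one h hM) with rfl | ⟨i, hi, -⟩
    · exact absurd rfl hne
    · exact ⟨i, hi⟩
  · rintro ⟨i, rfl⟩
    refine ⟨fun hw => Chart.mul_simple_ne w i (h.chamberOf_injective hK κ hw).symm,
      (κ.chamber w).erase (κ.vert w i), ?_, Finset.erase_subset _ _,
      κ.erase_subset_chamber_iff.2 (Or.inr rfl)⟩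
    exact (h.isPanel_iff hM (h.chamberOf hK κ w) (Finset.erase_subset _ _)).2
      (κ.card_chamber_erase w i)

theorem exists_walk {K : SimplexComplex V} (hK : K ∈ 𝓐) (κ : Chart K M) (n : ℕ) :
    ∀ w u : M.Group, M.len u = n → ∃ p : Δ.chamberGraph.Walk (h.chamberOf hK κ w)
      (h.chamberOf hK κ (w * u)), p.length = n := by
  induction n with
  | zero =>
    intro w u hu
    obtain rfl := M.toCoxeterSystem.length_eq_zero_iff.1 hu
    rw [mul_one]
    exact ⟨SimpleGraph.Walk.nil, rfl⟩
  | succ n ih =>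
    intro w u hu
    have hu1 : u ≠ 1 := by
      rintro rfl
      rw [CoxeterMatrix.len, CoxeterSystem.length_one] at hu
      omega
    obtain ⟨i, hi⟩ := M.toCoxeterSystem.exists_rightDescent_of_ne_one hu1
    have h1 := M.toCoxeterSystem.isRightDescent_iff.1 hi
    obtain ⟨p, hp⟩ := ih w (u * M.simple i) (by
      have : M.len (u * M.simple i) + 1 = M.len u := h1
      omega)
    have hadj : Δ.chamberGraph.Adj (h.chamberOf hK κ (w * (u * M.simple i)))
        (h.chamberOf hK κ (w * u)) :=
      (h.adjacent_chamberOf hM hK κ).2 ⟨i, by rw [← mul_assoc, M.mul_simple_mul_simple]⟩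
    exact ⟨p.concat hadj, by rw [SimpleGraph.Walk.length_concat, hp]⟩

theorem chamberGraph_reachable (X Y : Δ.chambers) : Δ.chamberGraph.Reachable X Y := by
  obtain ⟨K, hK, hX, hY⟩ := h.exists_apartment_chambers X Y
  obtain ⟨κ⟩ := hM K hK
  obtain ⟨w, rfl⟩ := h.exists_chamberOf_eq hK κ hX
  obtain ⟨u, rfl⟩ := h.exists_chamberOf_eq hK κ hY
  obtain ⟨p, -⟩ := h.exists_walk hM hK κ _ w (w⁻¹ * u) rfl
  rw [mul_inv_cancel_left] at p
  exact ⟨p⟩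

theorem dist_eq_zero {X Y : Δ.chambers} : dist X Y = 0 ↔ X = Y :=
  (h.chamberGraph_reachable hM X Y).dist_eq_zero_iff

theorem dist_triangle (X Y Z : Δ.chambers) : dist X Z ≤ dist X Y + dist Y Z :=
  SimpleGraph.Connected.dist_triangle
    ((SimpleGraph.connected_iff _).2 ⟨h.chamberGraph_reachable hM, ⟨X⟩⟩)

/-- The labelling of chambers by a retraction does not increase distances. -/
theorem len_le_dist {r : Δ.chambers → M.Group}
    (hr : ∀ X Y, Δ.Adjacent X Y → r Y = r X ∨ ∃ i, r Y = r X * M.simple i) (X Y : Δ.chambers) :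
    M.len ((r X)⁻¹ * r Y) ≤ dist X Y := by
  obtain ⟨p, hp⟩ := (h.chamberGraph_reachable hM X Y).exists_walk_length_eq_dist
  rw [dist, ← hp]
  clear hp
  induction p with
  | nil => simp [CoxeterMatrix.len]
  | cons hadj p ih =>
    rename_i X Z Y
    rw [SimpleGraph.Walk.length_cons]
    rcases hr X Z hadj with he | ⟨i, he⟩
    · rw [← he]; omega
    · have h1 : (r X)⁻¹ * r Y = M.simple i * ((r Z)⁻¹ * r Y) := by
        rw [he, mul_inv_rev, M.simple_inv, mul_assoc, ← mul_assoc (M.simple i),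
          M.simple_mul_self, one_mul]
      have h2 := M.toCoxeterSystem.length_mul_le (M.simple i) ((r Z)⁻¹ * r Y)
      have h3 : M.toCoxeterSystem.length (M.simple i) = 1 := M.toCoxeterSystem.length_simple i
      rw [h1]
      change M.toCoxeterSystem.length _ ≤ _
      change M.toCoxeterSystem.length _ ≤ _ at ih
      omega

/-- The gallery distance inside an apartment is the length in the Coxeter group. -/
theorem dist_chamberOf {K : SimplexComplex V} (hK : K ∈ 𝓐) (κ : Chart K M) (w w' : M.Group) :
    dist (h.chamberOf hK κ w) (h.chamberOf hK κ w') = M.len (w⁻¹ * w') := by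
  apply le_antisymm
  · obtain ⟨p, hp⟩ := h.exists_walk hM hK κ _ w (w⁻¹ * w') rfl
    have := SimpleGraph.dist_le p
    rw [hp] at this
    rwa [mul_inv_cancel_left] at this
  · obtain ⟨r, hr, -, -, hadj⟩ := h.exists_retraction hM hK κ 1
    have := h.len_le_dist hM hadj (h.chamberOf hK κ w) (h.chamberOf hK κ w')
    rwa [hr, hr] at this

/-- Apartments are thin. -/
theorem eq_of_subset_of_ne {K : SimplexComplex V} (hK : K ∈ 𝓐) {X Y Z : Δ.chambers}
    (hX : X.1 ∈ K.chambers) (hY : Y.1 ∈ K.chambers) (hZ : Z.1 ∈ K.chambers) {P : Finset V}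
    (hP : Δ.IsPanel P) (hPX : P ⊆ X.1) (hPY : P ⊆ Y.1) (hPZ : P ⊆ Z.1) (hXY : X ≠ Y)
    (hXZ : X ≠ Z) : Y = Z := by
  obtain ⟨κ⟩ := hM K hK
  obtain ⟨x, rfl⟩ := h.exists_chamberOf_eq hK κ hX
  obtain ⟨y, rfl⟩ := h.exists_chamberOf_eq hK κ hY
  obtain ⟨z, rfl⟩ := h.exists_chamberOf_eq hK κ hZ
  obtain ⟨i, rfl⟩ := κ.exists_eq_erase hPX (hP.card_add_one h hM)
  rcases κ.erase_subset_chamber_iff.1 hPY with rfl | rfl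
  · exact absurd rfl hXY
  rcases κ.erase_subset_chamber_iff.1 hPZ with rfl | rfl
  · exact absurd rfl hXZ
  rfl

theorem exists_ne_of_subset {K : SimplexComplex V} (hK : K ∈ 𝓐) {X : Δ.chambers}
    (hX : X.1 ∈ K.chambers) {P : Finset V} (hP : Δ.IsPanel P) (hPX : P ⊆ X.1) :
    ∃ Y : Δ.chambers, Y.1 ∈ K.chambers ∧ P ⊆ Y.1 ∧ X ≠ Y := by
  obtain ⟨κ⟩ := hM K hK
  obtain ⟨x, rfl⟩ := h.exists_chamberOf_eq hK κ hX
  obtain ⟨i, rfl⟩ := κ.exists_eq_erase hPX (hP.card_add_one h hM)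
  exact ⟨h.chamberOf hK κ (x * M.simple i), h.chamberOf_mem hK κ _,
    κ.erase_subset_chamber_iff.2 (Or.inr rfl), fun he =>
      Chart.mul_simple_ne x i (h.chamberOf_injective hK κ he).symm⟩

/-- Two adjacent chambers of an apartment have different distances to a third one. -/
theorem dist_ne {K : SimplexComplex V} (hK : K ∈ 𝓐) {C D E : Δ.chambers}
    (hC : C.1 ∈ K.chambers) (hD : D.1 ∈ K.chambers) (hE : E.1 ∈ K.chambers)
    (hCD : Δ.Adjacent C D) : dist C E ≠ dist D E := by
  obtain ⟨κ⟩ := hM K hK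
  obtain ⟨c, rfl⟩ := h.exists_chamberOf_eq hK κ hC
  obtain ⟨d, rfl⟩ := h.exists_chamberOf_eq hK κ hD
  obtain ⟨e, rfl⟩ := h.exists_chamberOf_eq hK κ hE
  obtain ⟨i, rfl⟩ := (h.adjacent_chamberOf hM hK κ).1 hCD
  rw [h.dist_chamberOf hM, h.dist_chamberOf hM, mul_inv_rev, M.simple_inv, mul_assoc]
  exact (M.toCoxeterSystem.length_simple_mul_ne (c⁻¹ * e) i).symm

/-- The beginning of a minimal gallery in an apartment. -/
theorem exists_adjacent_dist {K : SimplexComplex V} (hK : K ∈ 𝓐) {C E : Δ.chambers}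
    (hC : C.1 ∈ K.chambers) (hE : E.1 ∈ K.chambers) (hCE : C ≠ E) :
    ∃ C₁ : Δ.chambers, C₁.1 ∈ K.chambers ∧ Δ.Adjacent C C₁ ∧ dist C₁ E + 1 = dist C E := by
  obtain ⟨κ⟩ := hM K hK
  obtain ⟨c, rfl⟩ := h.exists_chamberOf_eq hK κ hC
  obtain ⟨e, rfl⟩ := h.exists_chamberOf_eq hK κ hE
  have hne : c⁻¹ * e ≠ 1 := fun h1 => hCE (by rw [inv_mul_eq_one.1 h1])
  obtain ⟨i, hi⟩ := M.toCoxeterSystem.exists_leftDescent_of_ne_one hne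
  refine ⟨h.chamberOf hK κ (c * M.simple i), h.chamberOf_mem hK κ _,
    (h.adjacent_chamberOf hM hK κ).2 ⟨i, rfl⟩, ?_⟩
  rw [h.dist_chamberOf hM, h.dist_chamberOf hM, mul_inv_rev, M.simple_inv, mul_assoc]
  exact M.toCoxeterSystem.isLeftDescent_iff.1 hi

/-- Let `P` be the common panel of two chambers `D` and `D₁` of an apartment. All the chambers
containing `P`, except for `D`, are at least as far from a chamber `C` of the apartment as `D₁`:
the retraction centered at `D` maps them to `D₁`. -/
theorem dist_le_of_panel {K : SimplexComplex V} (hK : K ∈ 𝓐) {C D D₁ F : Δ.chambers}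
    (hC : C.1 ∈ K.chambers) (hD : D.1 ∈ K.chambers) (hD₁ : D₁.1 ∈ K.chambers) {P : Finset V}
    (hP : Δ.IsPanel P) (hPD : P ⊆ D.1) (hPD₁ : P ⊆ D₁.1) (hPF : P ⊆ F.1) (hDD₁ : D ≠ D₁)
    (hDF : D ≠ F) : dist D₁ C ≤ dist F C := by
  obtain ⟨κ⟩ := hM K hK
  obtain ⟨c, rfl⟩ := h.exists_chamberOf_eq hK κ hC
  obtain ⟨d, rfl⟩ := h.exists_chamberOf_eq hK κ hD
  obtain ⟨r, hr, hr₀, hrP, hadj⟩ := h.exists_retraction hM hK κ d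
  -- The image of `F` contains `P` and differs from the center `D` because `F` does.
  have hF : D₁ = h.chamberOf hK κ (r F) := by
    refine h.eq_of_subset_of_ne hM hK hD hD₁ (h.chamberOf_mem hK κ _) hP hPD hPD₁
      (fun v hv => hrP F (Finset.mem_inter.2 ⟨hPF hv, hPD hv⟩)) hDD₁ fun he => hDF ?_
    exact (hr₀ F (h.chamberOf_injective hK κ he).symm).symm
  rw [hF, h.dist_chamberOf hM]
  have := h.len_le_dist hM hadj F (h.chamberOf hK κ c)
  rwa [hr] at this

/-- Apartments are convex. -/
theorem mem_of_dist_add_dist {K : SimplexComplex V} (hK : K ∈ 𝓐) {D X : Δ.chambers}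
    (hD : D.1 ∈ K.chambers) : ∀ {C : Δ.chambers}, C.1 ∈ K.chambers →
    dist C X + dist X D = dist C D → X.1 ∈ K.chambers := by
  intro C hC
  induction hn : dist C X generalizing C with
  | zero =>
    intro _
    rwa [← (h.dist_eq_zero hM).1 hn]
  | succ n ih =>
    intro hX
    have hCX : C ≠ X := by
      intro he
      rw [(h.dist_eq_zero hM).2 he] at hn
      omega
    obtain ⟨L, hL, hCL, hXL⟩ := h.exists_apartment_chambers C X
    obtain ⟨C₁, -, hadj, hd⟩ := h.exists_adjacent_dist hM hL hCL hXL hCX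
    have h1 := h.dist_triangle hM C₁ X D
    have h2 := h.dist_triangle hM C C₁ D
    have h3 : dist C C₁ = 1 := dist_eq_one.2 hadj
    refine ih (C := C₁) ?_ (by omega) (by omega)
    obtain ⟨-, P, hP, hPC, hPC₁⟩ := id hadj
    -- Otherwise no chamber on `P` except for the second one in `K` is nearer to `D` than `C`.
    obtain ⟨C', hC', hPC', hne⟩ := h.exists_ne_of_subset hM hK hC hP hPC
    by_contra hnot
    have hC'C₁ : C' ≠ C₁ := fun he => hnot (he ▸ hC')
    have := h.dist_le_of_panel hM hK hD hC' hC hP hPC' hPC hPC₁ hne.symm hC'C₁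
    omega

/-- Three pairwise adjacent chambers have a common panel. -/
theorem inter_subset_of_adjacent {X Y Z : Δ.chambers} (hXY : Δ.Adjacent X Y)
    (hYZ : Δ.Adjacent Y Z) (hXZ : Δ.Adjacent X Z) : X.1 ∩ Y.1 ⊆ Z.1 := by
  obtain ⟨K, hK, hX, hZ⟩ := h.exists_apartment_chambers X Z
  obtain ⟨κ⟩ := hM K hK
  obtain ⟨x, rfl⟩ := h.exists_chamberOf_eq hK κ hX
  obtain ⟨z, rfl⟩ := h.exists_chamberOf_eq hK κ hZ
  obtain ⟨r, hr, hr₀, hrP, hadj⟩ := h.exists_retraction hM hK κ x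
  have hYx : r Y ≠ x := fun he => hXY.1 (hr₀ Y he).symm
  have hXY' : Δ.Adjacent (h.chamberOf hK κ x) (h.chamberOf hK κ (r Y)) := by
    rw [h.adjacent_chamberOf hM hK κ]
    have := hadj _ _ hXY
    rw [hr] at this
    exact this.resolve_left hYx
  suffices hz : r Y = z by
    intro v hv
    rw [← hz]
    rw [Finset.inter_comm] at hv
    exact hrP Y hv
  have := hadj _ _ hYZ
  rw [hr] at this
  rcases this with he | he
  · exact he.symm
  · -- Otherwise the images of `X`, `Y` and `Z` are a triangle in the chamber graph of `K`.
    have hYZ' := (h.adjacent_chamberOf hM hK κ).2 he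
    exact absurd ((dist_eq_one.2 hXY').trans (dist_eq_one.2 hYZ'.symm).symm)
      (by
        rw [dist_comm (h.chamberOf hK κ z)]
        have := h.dist_ne hM hK hX hZ (h.chamberOf_mem hK κ (r Y)) hXZ
        rwa [dist_comm (h.chamberOf hK κ z)] at this)

end IsApartmentSystem
end SimplexComplex
end Buildings

/-! ### Adjacency is preserved and reflected -/

section ApartmentMaps

open scoped Classical

namespace SimplexComplex

variable {V V' B B' : Type*} {Δ : SimplexComplex V} {𝓐 : Set (SimplexComplex V)}

theorem IsThick.exists_ne (ht : Δ.IsThick) {P : Finset V} (hP : Δ.IsPanel P) (C D : Δ.chambers) :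
    ∃ F : Δ.chambers, P ⊆ F.1 ∧ F ≠ C ∧ F ≠ D := by
  by_contra! hcon
  have hsub : {F | F ∈ Δ.chambers ∧ P ⊆ F} ⊆ {C.1, D.1} := by
    rintro F ⟨hF, hPF⟩
    by_cases hFC : (⟨F, hF⟩ : Δ.chambers) = C
    · exact Or.inl (congrArg Subtype.val hFC)
    · exact Or.inr (congrArg Subtype.val (hcon ⟨F, hF⟩ hPF hFC))
  have h3 := (ht P hP).trans (Set.encard_le_encard hsub)
  have h2 := h3.trans (Set.encard_insert_le {D.1} C.1)
  rw [Set.encard_singleton] at h2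
  exact absurd h2 (by norm_num)

namespace IsApartmentSystem

/-- The intersection of all the apartments that contain two adjacent chambers `C` and `D` contains
no further chamber nearer to `C`. If `C₁` follows `C` on a minimal gallery towards such a chamber, then
a third chamber `F` containing `C ∩ C₁` gives an apartment that contains `D`, `C` and `F`. -/
theorem exists_notMem_of_dist_lt [Fintype B] (h : Δ.IsApartmentSystem 𝓐) {M : CoxeterMatrix B}
    (hM : ∀ K ∈ 𝓐, Nonempty (Chart K M)) (ht : Δ.IsThick) {K : SimplexComplex V} (hK : K ∈ 𝓐)
    {C D E : Δ.chambers} (hC : C.1 ∈ K.chambers) (hD : D.1 ∈ K.chambers) (hE : E.1 ∈ K.chambers)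
    (hCD : Δ.Adjacent C D) (hCE : C ≠ E) (hlt : dist C E < dist D E) :
    ∃ L ∈ 𝓐, C.1 ∈ L.chambers ∧ D.1 ∈ L.chambers ∧ E.1 ∉ L.chambers := by
  obtain ⟨C₁, hC₁, hadj, hd⟩ := h.exists_adjacent_dist hM hK hC hE hCE
  obtain ⟨P, hP, hPC, hPC₁⟩ := hadj.2
  obtain ⟨F, hPF, hFC, hFC₁⟩ := ht.exists_ne hP C C₁
  have hdC₁ : dist C C₁ = 1 := dist_eq_one.2 hadj
  have hdD : dist C D = 1 := dist_eq_one.2 hCD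
  -- `C` is nearer to `D` than `C₁`, hence on a minimal gallery from `F` to `D`.
  have h1 : dist C₁ D ≤ dist F D :=
    h.dist_le_of_panel hM hK hD hC hC₁ hP hPC hPC₁ hPF hadj.1 hFC.symm
  have h2 : dist C₁ D ≠ 1 := by
    have := h.dist_ne hM hK hC hC₁ hD hadj
    omega
  have h3 : dist C₁ D ≠ 0 := by
    intro h0
    rw [h.dist_eq_zero hM] at h0
    rw [h0] at hd
    omega
  have h4 : dist F C = 1 := dist_eq_one.2 ⟨hFC, P, hP, hPF, hPC⟩
  have h5 := h.dist_triangle hM F C D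
  obtain ⟨L, hL, hFL, hDL⟩ := h.exists_apartment_chambers F D
  have hCL : C.1 ∈ L.chambers := h.mem_of_dist_add_dist hM hL hDL hFL (by omega)
  refine ⟨L, hL, hCL, hDL, fun hEL => ?_⟩
  -- An apartment containing `C` and `E` contains `C₁`, but it cannot contain `C`, `C₁` and `F`.
  have hC₁L : C₁.1 ∈ L.chambers := h.mem_of_dist_add_dist hM hL hEL hCL (by omega)
  exact hFC₁ (h.eq_of_subset_of_ne hM hL hCL hFL hC₁L hP hPC hPF hPC₁ hFC.symm hadj.1)

/-- In a thick building, two adjacent chambers are the only chambers in the intersection of all the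
apartments that contain them. -/
theorem exists_notMem_of_adjacent [Fintype B] (h : Δ.IsApartmentSystem 𝓐) {M : CoxeterMatrix B}
    (hM : ∀ K ∈ 𝓐, Nonempty (Chart K M)) (ht : Δ.IsThick) {C D E : Δ.chambers}
    (hCD : Δ.Adjacent C D) (hCE : C ≠ E) (hDE : D ≠ E) :
    ∃ L ∈ 𝓐, C.1 ∈ L.chambers ∧ D.1 ∈ L.chambers ∧ E.1 ∉ L.chambers := by
  obtain ⟨K, hK, hC, hD⟩ := h.exists_apartment_chambers C D
  by_cases hE : E.1 ∈ K.chambers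
  · rcases lt_or_gt_of_ne (h.dist_ne hM hK hC hD hE hCD) with hlt | hlt
    · exact h.exists_notMem_of_dist_lt hM ht hK hC hD hE hCD hCE hlt
    · obtain ⟨L, hL, h1, h2, h3⟩ :=
        h.exists_notMem_of_dist_lt hM ht hK hD hC hE hCD.symm hDE hlt
      exact ⟨L, hL, h2, h1, h3⟩
  · exact ⟨K, hK, hC, hD, hE⟩

end IsApartmentSystem

/-- A map between the chambers of two complexes that carries the chambers of each apartment of the
first complex bijectively onto those of an apartment of the second one. -/
def MapsApartments {Δ : SimplexComplex V} {Δ' : SimplexComplex V'} (𝓐 : Set (SimplexComplex V))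
    (𝓐' : Set (SimplexComplex V')) (φ : Δ.chambers → Δ'.chambers) : Prop :=
  ∀ K ∈ 𝓐, ∃ K' ∈ 𝓐', Set.BijOn φ {C | C.1 ∈ K.chambers} {D | D.1 ∈ K'.chambers}

namespace MapsApartments

variable {Δ' : SimplexComplex V'} {𝓐' : Set (SimplexComplex V')} {φ : Δ.chambers → Δ'.chambers}
  (hφ : MapsApartments 𝓐 𝓐' φ) (h : Δ.IsApartmentSystem 𝓐)

include hφ h

theorem injective : Function.Injective φ := by
  intro C D hCD
  obtain ⟨K, hK, hC, hD⟩ := h.exists_apartment_chambers C D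
  obtain ⟨K', -, hbij⟩ := hφ K hK
  exact hbij.injOn hC hD hCD

theorem mem_iff {K : SimplexComplex V} {K' : SimplexComplex V'}
    (hb : Set.BijOn φ {C | C.1 ∈ K.chambers} {D | D.1 ∈ K'.chambers}) (C : Δ.chambers) :
    (φ C).1 ∈ K'.chambers ↔ C.1 ∈ K.chambers := by
  constructor
  · intro hC
    obtain ⟨D, hD, hDC⟩ := hb.surjOn hC
    rw [← hφ.injective h hDC]
    exact hD
  · exact fun hC => hb.mapsTo hC

variable [Fintype B] [Fintype B'] {M : CoxeterMatrix B} {M' : CoxeterMatrix B'}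
  (hM : ∀ K ∈ 𝓐, Nonempty (Chart K M)) (h' : Δ'.IsApartmentSystem 𝓐')
  (hM' : ∀ K ∈ 𝓐', Nonempty (Chart K M')) (ht : Δ.IsThick)

include hM h' hM' ht

/-- Adjacent chambers have adjacent images. A chamber on a minimal gallery between the images
belongs to all the apartments that contain them, and thus comes from the intersection of all the
apartments that contain the given chambers. -/
theorem adjacent_map {C D : Δ.chambers} (hCD : Δ.Adjacent C D) : Δ'.Adjacent (φ C) (φ D) := by
  by_contra hnot
  obtain ⟨K, hK, hC, hD⟩ := h.exists_apartment_chambers C D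
  obtain ⟨K', hK', hb⟩ := hφ K hK
  obtain ⟨E', hE', hadj, hd⟩ := h'.exists_adjacent_dist hM' hK' (hb.mapsTo hC) (hb.mapsTo hD)
    fun he => hCD.1 (hφ.injective h he)
  obtain ⟨E, hE, rfl⟩ := hb.surjOn hE'
  have hCE : C ≠ E := fun he => hadj.1 (by rw [he])
  have hDE : D ≠ E := fun he => hnot (he ▸ hadj)
  obtain ⟨L, hL, hCL, hDL, hEL⟩ := h.exists_notMem_of_adjacent hM ht hCD hCE hDE
  obtain ⟨L', hL', hbL⟩ := hφ L hL
  rw [← hφ.mem_iff h hbL] at hCL hDL hEL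
  have h1 : dist (φ C) (φ E) = 1 := dist_eq_one.2 hadj
  exact hEL (h'.mem_of_dist_add_dist hM' hL' hDL hCL (by omega))

/-- Chambers with adjacent images are adjacent. For suppose that `C` and `D` are not, let `C₁` be
the second chamber of a minimal gallery from `C` to `D`, and `F` a third chamber containing
`C ∩ C₁`. An apartment containing `F` and `D` contains `C₁` but not `C`, whereas the images of `C`,
`C₁` and `F` have a common panel, so that `φ C` lies between `φ F` and `φ D`. -/
theorem adjacent_iff {C D : Δ.chambers} : Δ.Adjacent C D ↔ Δ'.Adjacent (φ C) (φ D) := by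
  have hadjm := fun {X Y : Δ.chambers} => hφ.adjacent_map h hM h' hM' ht (C := X) (D := Y)
  have hinj := hφ.injective h
  refine ⟨fun hCD => hadjm hCD, fun hCD' => ?_⟩
  by_contra hnot
  have hne : C ≠ D := fun he => hCD'.1 (by rw [he])
  obtain ⟨K, hK, hC, hD⟩ := h.exists_apartment_chambers C D
  obtain ⟨C₁, hC₁, hadj, hd⟩ := h.exists_adjacent_dist hM hK hC hD hne
  obtain ⟨P, hP, hPC, hPC₁⟩ := hadj.2
  obtain ⟨F, hPF, hFC, hFC₁⟩ := ht.exists_ne hP C C₁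
  have hCF : Δ.Adjacent C F := ⟨hFC.symm, P, hP, hPC, hPF⟩
  have hC₁F : Δ.Adjacent C₁ F := ⟨hFC₁.symm, P, hP, hPC₁, hPF⟩
  have hDC₁ : D ≠ C₁ := fun he => hnot (he ▸ hadj)
  have hDF : D ≠ F := fun he => hnot (he ▸ hCF)
  have h1 : dist C D ≤ dist F D :=
    h.dist_le_of_panel hM hK hD hC₁ hC hP hPC₁ hPC hPF hadj.1.symm hFC₁.symm
  have h2 : dist F C₁ = 1 := dist_eq_one.2 hC₁F.symm
  have h3 := h.dist_triangle hM F C₁ D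
  obtain ⟨L, hL, hFL, hDL⟩ := h.exists_apartment_chambers F D
  have hC₁L : C₁.1 ∈ L.chambers := h.mem_of_dist_add_dist hM hL hDL hFL (by omega)
  have hCL : C.1 ∉ L.chambers := fun hCL =>
    hFC₁ (h.eq_of_subset_of_ne hM hL hCL hFL hC₁L hP hPC hPF hPC₁ hFC.symm hadj.1)
  obtain ⟨L', hL', hbL⟩ := hφ L hL
  have hQ := h'.inter_subset_of_adjacent hM' (hadjm hadj) (hadjm hC₁F) (hadjm hCF)
  by_cases hQD : (φ C).1 ∩ (φ C₁).1 ⊆ (φ D).1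
  · exact hFC₁ (hinj (h'.eq_of_subset_of_ne hM' hL' (hbL.mapsTo hDL) (hbL.mapsTo hFL)
      (hbL.mapsTo hC₁L) ((h'.adjacent_iff hM').1 (hadjm hadj)).2 hQD hQ
      Finset.inter_subset_right (fun he => hDF (hinj he)) fun he => hDC₁ (hinj he)))
  · have hFD : ¬ Δ'.Adjacent (φ F) (φ D) := fun hFD =>
      hQD ((Finset.subset_inter Finset.inter_subset_left hQ).trans
        (h'.inter_subset_of_adjacent hM' (hadjm hCF) hFD hCD'))
    rw [← dist_eq_one] at hFD
    have h4 : dist (φ F) (φ D) ≠ 0 := fun h0 =>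
      hDF (hinj ((h'.dist_eq_zero hM').1 h0)).symm
    have h5 : dist (φ F) (φ C) = 1 := dist_eq_one.2 (hadjm hCF).symm
    have h6 : dist (φ C) (φ D) = 1 := dist_eq_one.2 hCD'
    have h7 := h'.dist_triangle hM' (φ F) (φ C) (φ D)
    apply hCL
    rw [← hφ.mem_iff h hbL]
    exact h'.mem_of_dist_add_dist hM' hL' (hbL.mapsTo hDL) (hbL.mapsTo hFL) (by omega)

end MapsApartments
end SimplexComplex
end ApartmentMaps

/-! ### The image as a thick subbuilding -/

section ImageComplex

open scoped Classical

namespace SimplexComplex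

variable {V V' B B' : Type*} {Δ : SimplexComplex V} {𝓐 : Set (SimplexComplex V)}
  {Δ' : SimplexComplex V'} {𝓐' : Set (SimplexComplex V')} {φ : Δ.chambers → Δ'.chambers}

namespace IsApartmentSystem

variable [Fintype B] (h : Δ.IsApartmentSystem 𝓐) {M : CoxeterMatrix B}
  (hM : ∀ K ∈ 𝓐, Nonempty (Chart K M))

include h hM

theorem erase_subset_of_adjacent {C D : Δ.chambers} (hCD : Δ.Adjacent C D) {v : V}
    (hv : v ∈ C.1) (hvD : v ∉ D.1) : C.1.erase v ⊆ D.1 := by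
  obtain ⟨-, P, hP, hPC, hPD⟩ := hCD
  have hsub : P ⊆ C.1.erase v := Finset.subset_erase.2 ⟨hPC, fun hvP => hvD (hPD hvP)⟩
  have h1 := hP.card_add_one h hM
  have h2 := Finset.card_erase_add_one hv
  have h3 := h.card_eq hM C
  rw [← Finset.eq_of_subset_of_card_le hsub (by omega)]
  exact hPD

theorem isPanel_erase (C : Δ.chambers) {v : V} (hv : v ∈ C.1) : Δ.IsPanel (C.1.erase v) := by
  rw [h.isPanel_iff hM C (Finset.erase_subset _ _), Finset.card_erase_add_one hv, h.card_eq hM]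

/-- Chambers adjacent to `C` across the same panel are equal or adjacent. -/
theorem eq_or_adjacent {C D₁ D₂ : Δ.chambers} (h₁ : Δ.Adjacent C D₁) (h₂ : Δ.Adjacent C D₂) {v : V}
    (hv : v ∈ C.1) (hv₁ : v ∉ D₁.1) (hv₂ : v ∉ D₂.1) : D₁ = D₂ ∨ Δ.Adjacent D₁ D₂ :=
  or_iff_not_imp_left.2 fun hne => ⟨hne, _, h.isPanel_erase hM C hv,
    h.erase_subset_of_adjacent hM h₁ hv hv₁, h.erase_subset_of_adjacent hM h₂ hv hv₂⟩

/-- Chambers adjacent to `C` that are equal or adjacent share the same panel with `C`. -/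
theorem eq_of_adjacent {C D₁ D₂ : Δ.chambers} (h₁ : Δ.Adjacent C D₁) (h₂ : Δ.Adjacent C D₂)
    (h₁₂ : D₁ = D₂ ∨ Δ.Adjacent D₁ D₂) {v₁ v₂ : V} (hv₁ : v₁ ∈ C.1) (hv₂ : v₂ ∈ C.1)
    (hvD₁ : v₁ ∉ D₁.1) (hvD₂ : v₂ ∉ D₂.1) : v₁ = v₂ := by
  have hsub : C.1 ∩ D₁.1 ⊆ D₂.1 := by
    rcases h₁₂ with rfl | h₁₂
    · exact Finset.inter_subset_right
    · exact h.inter_subset_of_adjacent hM h₁ h₁₂ h₂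
  by_contra hne
  have hv : v₂ ∈ C.1.erase v₁ := Finset.mem_erase.2 ⟨Ne.symm hne, hv₂⟩
  exact hvD₂ (hsub (Finset.mem_inter.2 ⟨hv₂, h.erase_subset_of_adjacent hM h₁ hv₁ hvD₁ hv⟩))

theorem exists_mem_notMem {C D : Δ.chambers} (hCD : C ≠ D) : ∃ v ∈ C.1, v ∉ D.1 := by
  by_contra! hcon
  exact hCD (Subtype.ext (Finset.eq_of_subset_of_card_le hcon
    (by rw [h.card_eq hM, h.card_eq hM])))

/-- The chambers containing a given vertex are connected by galleries inside of an apartment. -/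
theorem star_induction {K : SimplexComplex V} (hK : K ∈ 𝓐) {p : Δ.chambers → Prop} {v : V}
    (step : ∀ X Y : Δ.chambers, X.1 ∈ K.chambers → Y.1 ∈ K.chambers → Δ.Adjacent X Y → v ∈ X.1 →
      v ∈ Y.1 → p X → p Y) {C D : Δ.chambers} (hC : C.1 ∈ K.chambers) (hD : D.1 ∈ K.chambers)
    (hvC : v ∈ C.1) (hvD : v ∈ D.1) (hp : p C) : p D := by
  obtain ⟨κ⟩ := hM K hK
  obtain ⟨c, rfl⟩ := h.exists_chamberOf_eq hK κ hC
  obtain ⟨d, rfl⟩ := h.exists_chamberOf_eq hK κ hD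
  obtain ⟨i, rfl⟩ := κ.mem_chamber.1 hvC
  have hmem : ∀ u ∈ M.maxParabolic i, κ.vert c i ∈ κ.chamber (c * u) := fun u hu => by
    rwa [κ.vert_mem_chamber, inv_mul_cancel_left]
  suffices H : ∀ u ∈ M.maxParabolic i, p (h.chamberOf hK κ (c * u)) by
    have := H _ (κ.vert_mem_chamber.1 hvD)
    rwa [mul_inv_cancel_left] at this
  have key : ∀ u ∈ M.maxParabolic i, ∀ j ∈ {j | j ≠ i}, p (h.chamberOf hK κ (c * u)) →
      p (h.chamberOf hK κ (c * (u * M.simple j))) := fun u hu j hj =>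
    step _ _ (h.chamberOf_mem hK κ _) (h.chamberOf_mem hK κ _)
      ((h.adjacent_chamberOf hM hK κ).2 ⟨j, by rw [mul_assoc]⟩) (hmem u hu)
      (hmem _ (mul_mem hu (M.simple_mem_maxParabolic hj)))
  intro u hu
  induction hu using Subgroup.closure_induction_right with
  | one => rwa [mul_one]
  | mul_right x hx y hy ih =>
    obtain ⟨j, hj, rfl⟩ := hy
    exact key x hx j hj ih
  | mul_inv_cancel x hx y hy ih =>
    obtain ⟨j, hj, rfl⟩ := hy
    rw [M.simple_inv]
    exact key x hx j hj ih

end IsApartmentSystem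

/-- The complex whose simplices are the faces of the values of `φ`. -/
def imageComplex (φ : Δ.chambers → Δ'.chambers) [Nonempty Δ.chambers] : SimplexComplex V' where
  faces := {s | ∃ C, s ⊆ (φ C).1}
  empty_mem := ⟨Classical.arbitrary _, Finset.empty_subset _⟩
  down_closed := fun _ ⟨C, hC⟩ _ ht => ⟨C, ht.trans hC⟩

theorem chambers_imageComplex [Nonempty Δ.chambers] :
    (imageComplex φ).chambers = Set.range (fun C : Δ.chambers => (φ C).1) := by
  have hmem : ∀ C, (φ C).1 ∈ (imageComplex φ).faces := fun C => ⟨C, subset_rfl⟩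
  ext s
  constructor
  · intro hs
    obtain ⟨C, hC⟩ := hs.1
    have hmax : Maximal (fun t => t ∈ (imageComplex φ).faces) s := hs
    exact ⟨C, (hmax.eq_of_le (hmem C) hC).symm⟩
  · rintro ⟨C, rfl⟩
    refine ⟨hmem C, ?_⟩
    rintro t ⟨D, hD⟩ hCt
    exact hD.trans ((φ C).2.2 (φ D).2.1 (hCt.trans hD))

namespace MapsApartments

variable (hφ : MapsApartments 𝓐 𝓐' φ) (h : Δ.IsApartmentSystem 𝓐) [Fintype B] [Fintype B']
  {M : CoxeterMatrix B} {M' : CoxeterMatrix B'} (hM : ∀ K ∈ 𝓐, Nonempty (Chart K M))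
  (h' : Δ'.IsApartmentSystem 𝓐') (hM' : ∀ K ∈ 𝓐', Nonempty (Chart K M')) (ht : Δ.IsThick)

include hφ h hM'

theorem isSubbuilding_imageComplex [Nonempty Δ.chambers] (h' : Δ'.IsApartmentSystem 𝓐') :
    (imageComplex φ).IsSubbuilding Δ' 𝓐' := by
  refine ⟨fun s ⟨C, hC⟩ => Δ'.down_closed _ (φ C).2.1 _ hC,
    {K' | K' ∈ 𝓐' ∧ ∃ K ∈ 𝓐, Set.BijOn φ {C | C.1 ∈ K.chambers} {D | D.1 ∈ K'.chambers}},
    fun K' hK' => hK'.1, ⟨?_, fun K' hK' => h'.isCoxeterComplex K' hK'.1, ?_,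
    fun K hK L hL => h'.exists_iso K hK.1 L hL.1⟩⟩
  · rintro K' ⟨hK', K, hK, hb⟩ s hs
    obtain ⟨κ⟩ := hM' K' hK'
    obtain ⟨w, hw⟩ := κ.mem_faces_iff.1 hs
    obtain ⟨C, -, hC⟩ := hb.surjOn (h'.chamberOf_mem hK' κ w)
    exact ⟨C, by rw [hC]; exact hw⟩
  · rintro s ⟨C, hC⟩ t ⟨D, hD⟩
    obtain ⟨K, hK, hCK, hDK⟩ := h.exists_apartment_chambers C D
    obtain ⟨K', hK', hb⟩ := hφ K hK
    exact ⟨K', ⟨hK', K, hK, hb⟩, K'.down_closed _ (hb.mapsTo hCK).1 _ hC,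
      K'.down_closed _ (hb.mapsTo hDK).1 _ hD⟩

include hM h' ht

/-- Each panel of `φ C` is shared with the image of a chamber adjacent to `C`. -/
theorem exists_adjacent_of_subset {C : Δ.chambers} {P : Finset V'} (hP : Δ'.IsPanel P)
    (hPC : P ⊆ (φ C).1) : ∃ D, Δ.Adjacent C D ∧ P ⊆ (φ D).1 := by
  obtain ⟨K, hK, hC, -⟩ := h.exists_apartment_chambers C C
  obtain ⟨K', hK', hb⟩ := hφ K hK
  obtain ⟨D', hD', hPD', hne⟩ := h'.exists_ne_of_subset hM' hK' (hb.mapsTo hC) hP hPC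
  obtain ⟨D, hD, rfl⟩ := hb.surjOn hD'
  exact ⟨D, (hφ.adjacent_iff h hM h' hM' ht).2 ⟨hne, P, hP, hPC, hPD'⟩, hPD'⟩

theorem isThick_imageComplex [Nonempty Δ.chambers] : (imageComplex φ).IsThick := by
  rintro P ⟨X, hX, hPX, hcard⟩
  rw [chambers_imageComplex] at hX ⊢
  obtain ⟨C, rfl⟩ := hX
  have hadj := fun {X Y : Δ.chambers} => hφ.adjacent_map h hM h' hM' ht (C := X) (D := Y)
  have hP : Δ'.IsPanel P := ⟨_, (φ C).2, hPX, hcard⟩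
  obtain ⟨D, hCD, hPD⟩ := hφ.exists_adjacent_of_subset h hM h' hM' ht hP hPX
  obtain ⟨Q, hQ, hQC, hQD⟩ := hCD.2
  obtain ⟨F, hQF, hFC, hFD⟩ := ht.exists_ne hQ C D
  have hCF : Δ.Adjacent C F := ⟨hFC.symm, Q, hQ, hQC, hQF⟩
  have hDF : Δ.Adjacent D F := ⟨hFD.symm, Q, hQ, hQD, hQF⟩
  have hPF : P ⊆ (φ F).1 := (Finset.subset_inter hPX hPD).trans
    (h'.inter_subset_of_adjacent hM' (hadj hCD) (hadj hDF) (hadj hCF))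
  have hne : ∀ {X Y : Δ.chambers}, Δ.Adjacent X Y → (φ X).1 ≠ (φ Y).1 :=
    fun hXY he => (hadj hXY).1 (Subtype.ext he)
  rw [← Set.encard_eq_three.2 ⟨_, _, _, hne hCD, hne hCF, hne hDF, rfl⟩]
  apply Set.encard_le_encard
  rintro Y (rfl | rfl | rfl)
  exacts [⟨⟨C, rfl⟩, hPX⟩, ⟨⟨D, rfl⟩, hPD⟩, ⟨⟨F, rfl⟩, hPF⟩]

/-- The map `φ` is an isometry with respect to the gallery distance. -/
theorem dist_map (X Y : Δ.chambers) : dist (φ X) (φ Y) = dist X Y := by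
  have hadj := fun {X Y : Δ.chambers} => hφ.adjacent_iff h hM h' hM' ht (C := X) (D := Y)
  obtain ⟨K, hK, hX, hY⟩ := h.exists_apartment_chambers X Y
  obtain ⟨K', hK', hb⟩ := hφ K hK
  apply le_antisymm
  · induction hn : dist X Y generalizing X with
    | zero => rw [(h.dist_eq_zero hM).1 hn, (h'.dist_eq_zero hM').2 rfl]
    | succ n ih =>
      have hne : X ≠ Y := by
        intro he
        rw [(h.dist_eq_zero hM).2 he] at hn
        omega
      obtain ⟨Z, hZ, hXZ, hd⟩ := h.exists_adjacent_dist hM hK hX hY hne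
      have h1 := ih Z hZ (by omega)
      have h2 := h'.dist_triangle hM' (φ X) (φ Z) (φ Y)
      have h3 : dist (φ X) (φ Z) = 1 := dist_eq_one.2 (hadj.1 hXZ)
      omega
  · induction hn : dist (φ X) (φ Y) generalizing X with
    | zero =>
      rw [hφ.injective h ((h'.dist_eq_zero hM').1 hn), (h.dist_eq_zero hM).2 rfl]
    | succ n ih =>
      have hne : φ X ≠ φ Y := by
        intro he
        rw [(h'.dist_eq_zero hM').2 he] at hn
        omega
      obtain ⟨Z', hZ', hXZ, hd⟩ :=
        h'.exists_adjacent_dist hM' hK' (hb.mapsTo hX) (hb.mapsTo hY) hne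
      obtain ⟨Z, hZ, rfl⟩ := hb.surjOn hZ'
      have h1 := ih Z hZ (by omega)
      have h2 := h.dist_triangle hM X Z Y
      have h3 : dist X Z = 1 := dist_eq_one.2 (hadj.2 hXZ)
      omega

end MapsApartments
end SimplexComplex
end ImageComplex

/-! ### The isomorphism in the 2-spherical case -/

section VertexMap

open scoped Classical

namespace SimplexComplex

variable {V V' B B' : Type*} {Δ : SimplexComplex V} {𝓐 : Set (SimplexComplex V)}
  {Δ' : SimplexComplex V'} {𝓐' : Set (SimplexComplex V')} {φ : Δ.chambers → Δ'.chambers}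

/-- The vertices `v` of `C` and `v'` of `φ C` correspond to each other if `φ` maps a chamber
adjacent to `C` across the panel opposite to `v` to a chamber adjacent to `φ C` across the panel
opposite to `v'`. -/
def Corresponds (φ : Δ.chambers → Δ'.chambers) (C : Δ.chambers) (v : V) (v' : V') : Prop :=
  v ∈ C.1 ∧ v' ∈ (φ C).1 ∧ ∃ D, Δ.Adjacent C D ∧ v ∉ D.1 ∧ v' ∉ (φ D).1

namespace MapsApartments

variable (hφ : MapsApartments 𝓐 𝓐' φ) (h : Δ.IsApartmentSystem 𝓐) [Fintype B] [Fintype B']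
  {M : CoxeterMatrix B} {M' : CoxeterMatrix B'} (hM : ∀ K ∈ 𝓐, Nonempty (Chart K M))
  (h' : Δ'.IsApartmentSystem 𝓐') (hM' : ∀ K ∈ 𝓐', Nonempty (Chart K M')) (ht : Δ.IsThick)

include hφ h hM h' hM' ht

theorem exists_corresponds_right {C : Δ.chambers} {v : V} (hv : v ∈ C.1) :
    ∃ v', Corresponds φ C v v' := by
  obtain ⟨D, hPD, hDC, -⟩ := ht.exists_ne (h.isPanel_erase hM C hv) C C
  have hCD : Δ.Adjacent C D :=
    ⟨hDC.symm, _, h.isPanel_erase hM C hv, Finset.erase_subset _ _, hPD⟩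
  have hvD : v ∉ D.1 := by
    intro hvD
    have hsub : C.1 ⊆ D.1 := by
      rw [← Finset.insert_erase hv]
      exact Finset.insert_subset hvD hPD
    obtain ⟨u, hu, huD⟩ := h.exists_mem_notMem hM hDC.symm
    exact huD (hsub hu)
  obtain ⟨v', hv', hvD'⟩ := h'.exists_mem_notMem hM' (hφ.adjacent_map h hM h' hM' ht hCD).1
  exact ⟨v', hv, hv', D, hCD, hvD, hvD'⟩

theorem exists_corresponds_left {C : Δ.chambers} {v' : V'} (hv' : v' ∈ (φ C).1) :
    ∃ v, Corresponds φ C v v' := by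
  obtain ⟨D, hCD, hPD⟩ := hφ.exists_adjacent_of_subset h hM h' hM' ht
    (h'.isPanel_erase hM' (φ C) hv') (Finset.erase_subset _ _)
  have hvD' : v' ∉ (φ D).1 := by
    intro hvD
    have hsub : (φ C).1 ⊆ (φ D).1 := by
      rw [← Finset.insert_erase hv']
      exact Finset.insert_subset hvD hPD
    obtain ⟨u, hu, huD⟩ := h'.exists_mem_notMem hM' (hφ.adjacent_map h hM h' hM' ht hCD).1
    exact huD (hsub hu)
  obtain ⟨v, hv, hvD⟩ := h.exists_mem_notMem hM hCD.1
  exact ⟨v, hv, hv', D, hCD, hvD, hvD'⟩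

theorem corresponds_right_unique {C : Δ.chambers} {v : V} {v₁ v₂ : V'}
    (h₁ : Corresponds φ C v v₁) (h₂ : Corresponds φ C v v₂) : v₁ = v₂ := by
  obtain ⟨hv, hv₁, D₁, hCD₁, hvD₁, hvD₁'⟩ := h₁
  obtain ⟨-, hv₂, D₂, hCD₂, hvD₂, hvD₂'⟩ := h₂
  have hadj := fun {X Y : Δ.chambers} => hφ.adjacent_map h hM h' hM' ht (C := X) (D := Y)
  exact h'.eq_of_adjacent hM' (hadj hCD₁) (hadj hCD₂)
    ((h.eq_or_adjacent hM hCD₁ hCD₂ hv hvD₁ hvD₂).imp (congrArg φ) hadj) hv₁ hv₂ hvD₁' hvD₂'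

theorem corresponds_left_unique {C : Δ.chambers} {v₁ v₂ : V} {v' : V'}
    (h₁ : Corresponds φ C v₁ v') (h₂ : Corresponds φ C v₂ v') : v₁ = v₂ := by
  obtain ⟨hv₁, hv, D₁, hCD₁, hvD₁, hvD₁'⟩ := h₁
  obtain ⟨hv₂, -, D₂, hCD₂, hvD₂, hvD₂'⟩ := h₂
  have hadj := fun {X Y : Δ.chambers} => hφ.adjacent_iff h hM h' hM' ht (C := X) (D := Y)
  exact h.eq_of_adjacent hM hCD₁ hCD₂
    ((h'.eq_or_adjacent hM' (hadj.1 hCD₁) (hadj.1 hCD₂) hv hvD₁' hvD₂').imp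
      (fun he => hφ.injective h he) hadj.2) hv₁ hv₂ hvD₁ hvD₂

/-- In a 2-spherical building the correspondence of vertices is the same for adjacent chambers. -/
theorem corresponds_of_adjacent (hfin : ∀ i j, M i j ≠ 0) {C D : Δ.chambers}
    (hCD : Δ.Adjacent C D) {v : V} {v' : V'} (hC : Corresponds φ C v v') (hvD : v ∈ D.1) :
    Corresponds φ D v v' := by
  obtain ⟨K, hK, hCK, hDK⟩ := h.exists_apartment_chambers C D
  obtain ⟨K', hK', hb⟩ := hφ K hK
  obtain ⟨κ⟩ := hM K hK
  obtain ⟨κ'⟩ := hM' K' hK'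
  -- The map between the two Coxeter groups that is induced by `φ` on the apartment `K`.
  have hex : ∀ w, ∃ w', φ (h.chamberOf hK κ w) = h'.chamberOf hK' κ' w' := fun w =>
    h'.exists_chamberOf_eq hK' κ' (hb.mapsTo (h.chamberOf_mem hK κ w))
  choose f hf using hex
  have hinj : Function.Injective f := by
    intro x y hxy
    have : φ (h.chamberOf hK κ x) = φ (h.chamberOf hK κ y) := by rw [hf, hf, hxy]
    exact h.chamberOf_injective hK κ (hφ.injective h this)
  have hsurj : Function.Surjective f := by
    intro y
    obtain ⟨X, hX, hXy⟩ := hb.surjOn (h'.chamberOf_mem hK' κ' y)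
    obtain ⟨x, rfl⟩ := h.exists_chamberOf_eq hK κ hX
    rw [hf] at hXy
    exact ⟨x, h'.chamberOf_injective hK' κ' hXy⟩
  let ψ : M.Group ≃ M'.Group := Equiv.ofBijective f ⟨hinj, hsurj⟩
  have hψf : ∀ x, ψ x = f x := fun _ => rfl
  have hψ : ∀ x y, M'.len ((ψ x)⁻¹ * ψ y) = M.len (x⁻¹ * y) := fun x y => by
    rw [hψf, hψf, ← h'.dist_chamberOf hM' hK' κ', ← hf, ← hf, hφ.dist_map h hM h' hM' ht,
      h.dist_chamberOf hM]
  have hstep : ∀ x i, ∃ a, ψ (x * M.simple i) = ψ x * M'.simple a := fun x i => by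
    have := hφ.adjacent_map h hM h' hM' ht ((h.adjacent_chamberOf hM hK κ).2 ⟨i, rfl⟩ :
      Δ.Adjacent (h.chamberOf hK κ x) (h.chamberOf hK κ (x * M.simple i)))
    rwa [hf, hf, h'.adjacent_chamberOf hM' hK' κ'] at this
  obtain ⟨w, rfl⟩ := h.exists_chamberOf_eq hK κ hCK
  obtain ⟨d, rfl⟩ := h.exists_chamberOf_eq hK κ hDK
  obtain ⟨j, rfl⟩ := (h.adjacent_chamberOf hM hK κ).1 hCD
  obtain ⟨i, rfl⟩ := κ.mem_chamber.1 hC.1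
  have hij : i ≠ j := by
    rintro rfl
    exact κ.vert_notMem_chamber_mul_simple w i hvD
  obtain ⟨a, ha⟩ := hstep w i
  obtain ⟨b, hb'⟩ := hstep w j
  have hab : a ≠ b := by
    rintro rfl
    rw [← ha] at hb'
    exact hij (M.simple_injective (mul_left_cancel (ψ.injective hb'))).symm
  have hbox := CoxeterMatrix.isometry_mul_simple ψ hψ hij (hfin i j) ha hb'
  have hv' : v' = κ'.vert (ψ w) a := by
    refine hφ.corresponds_right_unique h hM h' hM' ht hC ⟨hC.1, ?_,
      h.chamberOf hK κ (w * M.simple i), (h.adjacent_chamberOf hM hK κ).2 ⟨i, rfl⟩,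
      κ.vert_notMem_chamber_mul_simple w i, ?_⟩
    · rw [hf]
      exact κ'.vert_mem_chamber_self _ _
    · rw [hf, ← hψf, ha]
      exact κ'.vert_notMem_chamber_mul_simple _ _
  have hvb : κ'.vert (ψ w * M'.simple b) a = κ'.vert (ψ w) a := κ'.vert_mul_simple _ hab
  have hvj : κ.vert (w * M.simple j) i = κ.vert w i := κ.vert_mul_simple _ hij
  refine ⟨hvD, ?_, h.chamberOf hK κ (w * M.simple j * M.simple i),
    (h.adjacent_chamberOf hM hK κ).2 ⟨i, rfl⟩, ?_, ?_⟩
  · rw [hf, ← hψf, hb', hv', ← hvb]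
    exact κ'.vert_mem_chamber_self _ _
  · rw [← hvj]
    exact κ.vert_notMem_chamber_mul_simple _ _
  · rw [hf, ← hψf, hbox, hv', ← hvb]
    exact κ'.vert_notMem_chamber_mul_simple _ _

theorem corresponds_of_mem (hfin : ∀ i j, M i j ≠ 0) {C D : Δ.chambers} {v : V} {v' : V'}
    (hC : Corresponds φ C v v') (hvD : v ∈ D.1) : Corresponds φ D v v' := by
  obtain ⟨K, hK, hCK, hDK⟩ := h.exists_apartment_chambers C D
  exact h.star_induction hM hK (p := fun X => Corresponds φ X v v')
    (fun X Y _ _ hXY _ hvY hX => hφ.corresponds_of_adjacent h hM h' hM' ht hfin hXY hX hvY)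
    hCK hDK hC.1 hvD hC

/-- A vertex of the image corresponds to only one vertex: galleries in the star of `v'` in the image
of an apartment lift to galleries in the star of `v`. -/
theorem eq_of_corresponds (hfin : ∀ i j, M i j ≠ 0) {C D : Δ.chambers} {v u : V} {v' : V'}
    (hC : Corresponds φ C v v') (hD : Corresponds φ D u v') : v = u := by
  obtain ⟨K, hK, hCK, hDK⟩ := h.exists_apartment_chambers C D
  obtain ⟨K', hK', hb⟩ := hφ K hK
  have hp : ∃ X, φ X = φ D ∧ Corresponds φ X v v' := by
    refine h'.star_induction hM' hK' (p := fun X' => ∃ X, φ X = X' ∧ Corresponds φ X v v') ?_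
      (hb.mapsTo hCK) (hb.mapsTo hDK) hC.2.1 hD.2.1 ⟨C, rfl, hC⟩
    rintro X' Y' - hY' hadj' - hvY' ⟨X, rfl, hX⟩
    obtain ⟨Y, -, rfl⟩ := hb.surjOn hY'
    have hadj := (hφ.adjacent_iff h hM h' hM' ht).2 hadj'
    refine ⟨Y, rfl, hφ.corresponds_of_adjacent h hM h' hM' ht hfin hadj hX ?_⟩
    by_contra hvY
    obtain ⟨w', hw', hwY'⟩ := h'.exists_mem_notMem hM' hadj'.1
    rw [hφ.corresponds_right_unique h hM h' hM' ht hX ⟨hX.1, hw', Y, hadj, hvY, hwY'⟩] at hvY'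
    exact hwY' hvY'
  obtain ⟨X, hXD, hX⟩ := hp
  rw [hφ.injective h hXD] at hX
  exact hφ.corresponds_left_unique h hM h' hM' ht hX hD

/-- The simplicial isomorphism onto the image in the 2-spherical case. -/
theorem exists_iso_imageComplex [Nonempty Δ.chambers] (hfin : ∀ i j, M i j ≠ 0) :
    ∃ e : Iso Δ (imageComplex φ), ∀ C : Δ.chambers, e.imageOf C.1 = ↑(φ C).1 := by
  have hex : ∀ v : Δ.vertices, ∃ v' : V', ∀ C : Δ.chambers, v.1 ∈ C.1 →
      Corresponds φ C v.1 v' := by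
    intro v
    obtain ⟨C, hC⟩ := h.exists_subset_chamber hM v.2
    obtain ⟨v', hv'⟩ := hφ.exists_corresponds_right h hM h' hM' ht
      (hC (Finset.mem_singleton_self v.1))
    exact ⟨v', fun D hD => hφ.corresponds_of_mem h hM h' hM' ht hfin hv' hD⟩
  choose f hf using hex
  have hmem : ∀ v : Δ.vertices, ∃ C : Δ.chambers, v.1 ∈ C.1 := fun v =>
    (h.exists_subset_chamber hM v.2).imp fun C hC => hC (Finset.mem_singleton_self v.1)
  have hfv : ∀ v, f v ∈ (imageComplex φ).vertices := by
    intro v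
    obtain ⟨C, hC⟩ := hmem v
    exact ⟨C, Finset.singleton_subset_iff.2 (hf v C hC).2.1⟩
  have hof : ∀ (C : Δ.chambers) (v' : V'), v' ∈ (φ C).1 →
      ∃ v : Δ.vertices, v.1 ∈ C.1 ∧ f v = v' := by
    intro C v' hv'
    obtain ⟨v, hv⟩ := hφ.exists_corresponds_left h hM h' hM' ht hv'
    let u : Δ.vertices := ⟨v, mem_vertices_of_mem C.2.1 hv.1⟩
    exact ⟨u, hv.1, hφ.corresponds_right_unique h hM h' hM' ht (hf u C hv.1) hv⟩
  have hinj : ∀ u v, f u = f v → u = v := by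
    intro u v huv
    obtain ⟨C, hC⟩ := hmem u
    obtain ⟨D, hD⟩ := hmem v
    exact Subtype.ext (hφ.eq_of_corresponds h hM h' hM' ht hfin (huv ▸ hf u C hC) (hf v D hD))
  have hmem_iff : ∀ (C : Δ.chambers) (v : Δ.vertices), f v ∈ (φ C).1 ↔ v.1 ∈ C.1 := by
    intro C v
    constructor
    · intro hv
      obtain ⟨u, hu, huv⟩ := hof C _ hv
      rwa [← hinj u v huv]
    · exact fun hv => (hf v C hv).2.1
  let g : Δ.vertices → (imageComplex φ).vertices := fun v => ⟨f v, hfv v⟩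
  have hg : Function.Bijective g := by
    refine ⟨fun u v huv => hinj u v (congrArg Subtype.val huv), ?_⟩
    rintro ⟨v', C, hC⟩
    obtain ⟨v, -, hv⟩ := hof C v' (hC (Finset.mem_singleton_self v'))
    exact ⟨v, Subtype.ext hv⟩
  refine ⟨⟨Equiv.ofBijective g hg, fun s => ?_⟩, fun C => ?_⟩
  · have h1 : s.map (Function.Embedding.subtype _) ∈ Δ.faces ↔
        ∃ C : Δ.chambers, ∀ v ∈ s, v.1 ∈ C.1 := by
      constructor
      · intro hs
        obtain ⟨C, hC⟩ := h.exists_subset_chamber hM hs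
        exact ⟨C, fun v hv => hC (Finset.mem_map_of_mem _ hv)⟩
      · rintro ⟨C, hC⟩
        refine Δ.down_closed _ C.2.1 _ fun x hx => ?_
        obtain ⟨v, hv, rfl⟩ := Finset.mem_map.1 hx
        exact hC v hv
    rw [h1]
    refine exists_congr fun C => ?_
    rw [Finset.map_map]
    constructor
    · intro hC x hx
      obtain ⟨v, hv, rfl⟩ := Finset.mem_map.1 hx
      exact (hmem_iff C v).2 (hC v hv)
    · intro hC v hv
      exact (hmem_iff C v).1 (hC (Finset.mem_map_of_mem _ hv))
  · ext v'
    constructor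
    · rintro ⟨v, hv, rfl⟩
      exact (hmem_iff C v).2 hv
    · intro hv'
      exact hof C v' hv'

end MapsApartments
end SimplexComplex
end VertexMap

theorem mainTheorem6 {V V' : Type*}
    (Δ : SimplexComplex V) (𝓐 : Set (SimplexComplex V))
    (Δ' : SimplexComplex V') (𝓐' : Set (SimplexComplex V'))
    (h𝓐 : Δ.IsApartmentSystem 𝓐) (h𝓐' : Δ'.IsApartmentSystem 𝓐')
    (hthick : Δ.IsThick)
    (φ : Δ.chambers → Δ'.chambers)
    (hφ : ∀ K ∈ 𝓐, ∃ K' ∈ 𝓐',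
      Set.BijOn φ {C | C.1 ∈ K.chambers} {D | D.1 ∈ K'.chambers}) :
    Function.Injective φ ∧
    (∀ C D : Δ.chambers, Δ.Adjacent C D ↔ Δ'.Adjacent (φ C) (φ D)) ∧
    ∃ Γ : SimplexComplex V',
      Γ.IsSubbuilding Δ' 𝓐' ∧ Γ.IsThick ∧
      Γ.chambers = Set.range (fun C : Δ.chambers => (φ C).1) ∧
      (SimplexComplex.IsTwoSpherical 𝓐 →
        ∃ e : SimplexComplex.Iso Δ Γ, ∀ C : Δ.chambers, e.imageOf C.1 = ↑(φ C).1) := by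
  have hφ' : SimplexComplex.MapsApartments 𝓐 𝓐' φ := hφ
  obtain ⟨n, M, hM⟩ := h𝓐.exists_charts
  obtain ⟨n', M', hM'⟩ := h𝓐'.exists_charts
  obtain ⟨C, -⟩ := h𝓐.exists_subset_chamber hM Δ.empty_mem
  have : Nonempty Δ.chambers := ⟨C⟩
  refine ⟨hφ'.injective h𝓐, fun C D => hφ'.adjacent_iff h𝓐 hM h𝓐' hM' hthick,
    SimplexComplex.imageComplex φ, hφ'.isSubbuilding_imageComplex h𝓐 hM' h𝓐',
    hφ'.isThick_imageComplex h𝓐 hM h𝓐' hM' hthick, SimplexComplex.chambers_imageComplex, ?_⟩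
  rintro ⟨m, N, hfin, hN⟩
  have hN' : ∀ K ∈ 𝓐, Nonempty (SimplexComplex.Chart K N) := fun K hK =>
    (hN K hK).map fun e => (SimplexComplex.Chart.self N).comap e
  exact hφ'.exists_iso_imageComplex h𝓐 hN' h𝓐' hM' hthick hfin
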